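/- Conventions. Let $\mathbb G=(A,\delta,h)$ be a compact Kac algebra: $A$ is a von Neumann algebra, $\delta\colon A\to A\otimes A$ is an injective normal unital $*$-homomorphism with $(\delta\otimes\mathrm{id})\delta=(\mathrm{id}\otimes\delta)\delta$, and $h$ is a faithful normal tracial state with $(\mathrm{id}\otimes h)(\delta(a))=h(a)1=(h\otimes\mathrm{id})(\delta(a))$ for all $a\in A$; here $\otimes$ is the von Neumann algebra tensor product. We let $A$ act on the GNS space $L^2(\mathbb G)$ of $h$, with cyclic vector $\hat 1$. Let $V$ be the multiplicative unitary on $L^2(\mathbb G)\otimes L^2(\mathbb G)$ given by $V^*(x\hat 1\otimes y\hat 1)=\delta(y)(x\hat 1\otimes\hat 1)$ for $x,y\in A$, and let $\hat A$ be the von Neumann algebra on $L^2(\mathbb G)$ generated by $\{(\theta\otimes\mathrm{id})(V):\theta\in A_*\}$, with commutant $\hat A'$. An action of $\mathbb G$ on a von Neumann algebra $M$ is an injective normal unital $*$-homomorphism $\alpha\colon M\to M\otimes A$ with $(\alpha\otimes\mathrm{id})\alpha=(\mathrm{id}\otimes\delta)\alpha$. Its crossed product is the von Neumann algebra $M\rtimes_\alpha\mathbb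 G=\alpha(M)\vee(\mathbb C\otimes\hat A')\subset M\otimes B(L^2(\mathbb G))$. An $\alpha$-cocycle is a unitary $w\in M\otimes A$ with $(w\otimes 1)(\alpha\otimes\mathrm{id})(w)=(\mathrm{id}\otimes\delta)(w)$. It is a coboundary if there is a unitary $u\in M$ with $(u\otimes 1)\,w\,\alpha(u^*)=1$. Theorem. Let $M$ be a finite von Neumann algebra (every isometry in $M$ is unitary) and let $\alpha$ be an action of a compact Kac algebra $\mathbb G$ on $M$. If $M\rtimes_\alpha\mathbb G$ is a factor, then every $\alpha$-cocycle is a coboundary. -/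

import Mathlib

namespace KacAction

noncomputable section

open UniformSpace TensorProduct

set_option linter.unusedSectionVars false

section HilbertTensor

variable {H K L H' K' : Type*}
  [NormedAddCommGroup H] [InnerProductSpace ℂ H]
  [NormedAddCommGroup K] [InnerProductSpace ℂ K]
  [NormedAddCommGroup L] [InnerProductSpace ℂ L]
  [NormedAddCommGroup H'] [InnerProductSpace ℂ H']
  [NormedAddCommGroup K'] [InnerProductSpace ℂ K']

/-- The Hilbert space tensor product of `H` and `K`. -/
abbrev HT (H K : Type*) [NormedAddCommGroup H] [InnerProductSpace ℂ H]
    [NormedAddCommGroup K] [InnerProductSpace ℂ K] : Type _ :=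
  Completion (H ⊗[ℂ] K)

/-- The elementary tensor `ξ ⊗ η`. -/
def tmul (ξ : H) (η : K) : HT H K := ((ξ ⊗ₜ[ℂ] η : H ⊗[ℂ] K) : Completion (H ⊗[ℂ] K))

/-- The operator `η ↦ ξ ⊗ η`. -/
def leftLeg (ξ : H) : K →L[ℂ] HT H K := Completion.toComplL ∘L mkL ℂ H K ξ

/-- The operator `ξ ↦ ξ ⊗ η`. -/
def rightLeg (η : K) : H →L[ℂ] HT H K := Completion.toComplL ∘L (mkL ℂ H K).flip η

@[simp] theorem leftLeg_apply (ξ : H) (η : K) : leftLeg ξ η = tmul ξ η := rfl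
@[simp] theorem rightLeg_apply (ξ : H) (η : K) : rightLeg η ξ = tmul ξ η := rfl

@[simp] theorem inner_tmul_tmul (ξ ξ' : H) (η η' : K) :
    inner ℂ (tmul ξ η) (tmul ξ' η') = inner ℂ ξ ξ' * inner ℂ η η' := by
  simp [tmul]

theorem submodule_eq_top (S : Submodule ℂ (HT H K)) (hS : IsClosed (S : Set (HT H K)))
    (h : ∀ ξ η, tmul ξ η ∈ S) : S = ⊤ := by
  rw [eq_top_iff]
  rintro x -
  induction x using Completion.induction_on with
  | hp => exact hS
  | ih a =>
    induction a using TensorProduct.induction_on with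
    | zero => rw [Completion.coe_zero]; exact S.zero_mem
    | tmul ξ η => exact h ξ η
    | add a b ha hb => rw [Completion.coe_add]; exact S.add_mem ha hb

theorem clm_ext {E : Type*} [NormedAddCommGroup E] [NormedSpace ℂ E] {S T : HT H K →L[ℂ] E}
    (h : ∀ ξ η, S (tmul ξ η) = T (tmul ξ η)) : S = T := by
  have := submodule_eq_top (LinearMap.eqLocus S.toLinearMap T.toLinearMap)
    (isClosed_eq S.continuous T.continuous) h
  ext x
  have hx : x ∈ LinearMap.eqLocus S.toLinearMap T.toLinearMap := this ▸ Submodule.mem_top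
  exact hx

theorem ext_inner {x y : HT H K} (h : ∀ ξ η, inner ℂ (tmul ξ η) x = inner ℂ (tmul ξ η) y) :
    x = y := by
  rw [← sub_eq_zero]
  have : innerSL ℂ (x - y) = 0 := clm_ext fun ξ η => by
    rw [zero_apply, innerSL_apply_apply, ← inner_conj_symm, inner_sub_right, h,
      sub_self, map_zero]
  have h2 := congrArg (fun f => f (x - y)) this
  rwa [innerSL_apply_apply, zero_apply, inner_self_eq_zero] at h2

theorem clm_ext_inner {S T : HT H K →L[ℂ] HT H' K'}
    (h : ∀ ξ' η' ξ η, inner ℂ (tmul ξ' η') (S (tmul ξ η)) = inner ℂ (tmul ξ' η') (T (tmul ξ η))) :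
    S = T := clm_ext fun ξ η => ext_inner fun ξ' η' => h ξ' η' ξ η

/-- The operator `S ⊗ T`. -/
def opTensor (S : H →L[ℂ] H') (T : K →L[ℂ] K') : HT H K →L[ℂ] HT H' K' := (mapL S T).completion

@[simp] theorem opTensor_tmul (S : H →L[ℂ] H') (T : K →L[ℂ] K') (ξ : H) (η : K) :
    opTensor S T (tmul ξ η) = tmul (S ξ) (T η) := by
  simp [opTensor, tmul]

/-- The flip `ξ ⊗ η ↦ η ⊗ ξ`. -/
def swap (H K : Type*) [NormedAddCommGroup H] [InnerProductSpace ℂ H]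
    [NormedAddCommGroup K] [InnerProductSpace ℂ K] : HT H K →L[ℂ] HT K H :=
  (commIsometry ℂ H K : H ⊗[ℂ] K →L[ℂ] K ⊗[ℂ] H).completion

@[simp] theorem swap_tmul (ξ : H) (η : K) : swap H K (tmul ξ η) = tmul η ξ := by
  simp [swap, tmul]

/-- The algebraic tensor product inside `(H ⊗ K) ⊗ L`. -/
def assocSource (H K L : Type*) [NormedAddCommGroup H] [InnerProductSpace ℂ H]
    [NormedAddCommGroup K] [InnerProductSpace ℂ K] [NormedAddCommGroup L] [InnerProductSpace ℂ L] :
    (H ⊗[ℂ] K) ⊗[ℂ] L →ₗᵢ[ℂ] HT (HT H K) L :=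
  (Completion.toComplₗᵢ).comp ((Completion.toComplₗᵢ (𝕜 := ℂ) (E := H ⊗[ℂ] K)).rTensor L)

/-- The algebraic tensor product mapped to `H ⊗ (K ⊗ L)`. -/
def assocTarget (H K L : Type*) [NormedAddCommGroup H] [InnerProductSpace ℂ H]
    [NormedAddCommGroup K] [InnerProductSpace ℂ K] [NormedAddCommGroup L] [InnerProductSpace ℂ L] :
    (H ⊗[ℂ] K) ⊗[ℂ] L →ₗᵢ[ℂ] HT H (HT K L) :=
  (Completion.toComplₗᵢ).comp (((Completion.toComplₗᵢ (𝕜 := ℂ) (E := K ⊗[ℂ] L)).lTensor H).comp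
    (assocIsometry ℂ H K L).toLinearIsometry)

/-- The canonical unitary `(H ⊗ K) ⊗ L → H ⊗ (K ⊗ L)`. -/
def assocMap (H K L : Type*) [NormedAddCommGroup H] [InnerProductSpace ℂ H]
    [NormedAddCommGroup K] [InnerProductSpace ℂ K] [NormedAddCommGroup L] [InnerProductSpace ℂ L] :
    HT (HT H K) L →L[ℂ] HT H (HT K L) :=
  (assocTarget H K L).toLinearMap.extendOfNorm (assocSource H K L).toLinearMap

theorem tmul_assocSource (ξ : H) (η : K) (ζ : L) :
    assocSource H K L ((ξ ⊗ₜ η) ⊗ₜ ζ) = tmul (tmul ξ η) ζ := rfl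

theorem tmul_assocTarget (ξ : H) (η : K) (ζ : L) :
    assocTarget H K L ((ξ ⊗ₜ η) ⊗ₜ ζ) = tmul ξ (tmul η ζ) := rfl

theorem denseRange_assocSource : DenseRange (assocSource H K L).toLinearMap := by
  have key := submodule_eq_top (H := HT H K) (K := L)
    (LinearMap.range (assocSource H K L).toLinearMap).topologicalClosure
    (Submodule.isClosed_topologicalClosure _) (fun x ζ => by
      have := submodule_eq_top (H := H) (K := K)
        ((LinearMap.range (assocSource H K L).toLinearMap).topologicalClosure.comap
          (rightLeg (H := HT H K) ζ).toLinearMap)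
        ((Submodule.isClosed_topologicalClosure _).preimage
          (rightLeg (H := HT H K) ζ).continuous)
        (fun ξ η => Submodule.le_topologicalClosure _ ⟨(ξ ⊗ₜ η) ⊗ₜ ζ, rfl⟩)
      have hx : x ∈ ((LinearMap.range (assocSource H K L).toLinearMap).topologicalClosure.comap
          (rightLeg (H := HT H K) ζ).toLinearMap) := this ▸ Submodule.mem_top
      exact hx)
  intro x
  have hx : x ∈ (LinearMap.range (assocSource H K L).toLinearMap).topologicalClosure :=
    key ▸ Submodule.mem_top
  exact hx

@[simp] theorem assocMap_tmul (ξ : H) (η : K) (ζ : L) :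
    assocMap H K L (tmul (tmul ξ η) ζ) = tmul ξ (tmul η ζ) :=
  LinearMap.extendOfNorm_eq (f := (assocTarget H K L).toLinearMap)
    (e := (assocSource H K L).toLinearMap) denseRange_assocSource
    ⟨1, fun x => by
      rw [one_mul]
      exact ((assocTarget H K L).norm_map x).trans ((assocSource H K L).norm_map x).symm |>.le⟩
    ((ξ ⊗ₜ η) ⊗ₜ ζ)

theorem opTensor_mul (S S' : H →L[ℂ] H) (T T' : K →L[ℂ] K) :
    opTensor S T * opTensor S' T' = opTensor (S * S') (T * T') :=
  clm_ext fun ξ η => by simp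

theorem tmul_sum_left {ι : Type*} (s : Finset ι) (f : ι → H) (η : K) :
    tmul (∑ i ∈ s, f i) η = ∑ i ∈ s, tmul (f i) η := map_sum (rightLeg η) f s

theorem tmul_sum_right {ι : Type*} (s : Finset ι) (ξ : H) (f : ι → K) :
    tmul ξ (∑ i ∈ s, f i) = ∑ i ∈ s, tmul ξ (f i) := map_sum (leftLeg ξ) f s

theorem tmul_add (ξ : H) (η η' : K) : tmul ξ (η + η') = tmul ξ η + tmul ξ η' :=
  map_add (leftLeg ξ) η η'
theorem add_tmul (ξ ξ' : H) (η : K) : tmul (ξ + ξ') η = tmul ξ η + tmul ξ' η :=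
  map_add (rightLeg η) ξ ξ'
theorem tmul_smul (c : ℂ) (ξ : H) (η : K) : tmul ξ (c • η) = c • tmul ξ η :=
  map_smul (leftLeg ξ) c η
theorem smul_tmul (c : ℂ) (ξ : H) (η : K) : tmul (c • ξ) η = c • tmul ξ η :=
  map_smul (rightLeg η) c ξ

theorem norm_opTensor_le (S : H →L[ℂ] H') (T : K →L[ℂ] K') : ‖opTensor S T‖ ≤ ‖S‖ * ‖T‖ := by
  refine ContinuousLinearMap.opNorm_le_bound _ (by positivity) fun x => ?_
  induction x using Completion.induction_on with
  | hp => exact isClosed_le (by fun_prop) (by fun_prop)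
  | ih a =>
    simp only [opTensor, ContinuousLinearMap.completion_apply_coe, Completion.norm_coe]
    exact (mapL S T).le_of_opNorm_le (norm_mapL_le S T) a

variable [CompleteSpace H] [CompleteSpace K]

theorem star_opTensor (S : H →L[ℂ] H) (T : K →L[ℂ] K) :
    star (opTensor S T) = opTensor (star S) (star T) :=
  clm_ext_inner fun ξ' η' ξ η => by
    rw [ContinuousLinearMap.star_eq_adjoint, ContinuousLinearMap.adjoint_inner_right]
    simp [ContinuousLinearMap.star_eq_adjoint, ContinuousLinearMap.adjoint_inner_right]

/-- The slice `(id ⊗ ω)(X)` by the vector functional `ω(T) = ⟪η, T η'⟫` of the second leg. -/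
def sliceR (η η' : K) (X : HT H K →L[ℂ] HT H K) : H →L[ℂ] H :=
  (rightLeg η).adjoint ∘L X ∘L rightLeg η'

/-- The slice `(ω ⊗ id)(X)` by the vector functional `ω(T) = ⟪ξ, T ξ'⟫` of the first leg. -/
def sliceL (ξ ξ' : H) (X : HT H K →L[ℂ] HT H K) : K →L[ℂ] K :=
  (leftLeg ξ).adjoint ∘L X ∘L leftLeg ξ'

theorem inner_sliceR (η η' : K) (X : HT H K →L[ℂ] HT H K) (ξ ξ' : H) :
    inner ℂ ξ (sliceR η η' X ξ') = inner ℂ (tmul ξ η) (X (tmul ξ' η')) := by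
  simp [sliceR, ContinuousLinearMap.adjoint_inner_right]

theorem inner_sliceL (ξ ξ' : H) (X : HT H K →L[ℂ] HT H K) (η η' : K) :
    inner ℂ η (sliceL ξ ξ' X η') = inner ℂ (tmul ξ η) (X (tmul ξ' η')) := by
  simp [sliceL, ContinuousLinearMap.adjoint_inner_right]

theorem sliceR_opTensor (S : H →L[ℂ] H) (T : K →L[ℂ] K) (η η' : K) :
    sliceR η η' (opTensor S T) = (inner ℂ η (T η') : ℂ) • S := by
  ext ξ'
  refine ext_inner_left ℂ fun ξ => ?_
  rw [inner_sliceR]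
  simp [inner_smul_right, mul_comm]

theorem sliceL_opTensor (S : H →L[ℂ] H) (T : K →L[ℂ] K) (ξ ξ' : H) :
    sliceL ξ ξ' (opTensor S T) = (inner ℂ ξ (S ξ') : ℂ) • T := by
  ext η'
  refine ext_inner_left ℂ fun η => ?_
  rw [inner_sliceL]
  simp [inner_smul_right]

theorem ext_sliceR {X Y : HT H K →L[ℂ] HT H K} (h : ∀ η η', sliceR η η' X = sliceR η η' Y) :
    X = Y := clm_ext_inner fun ξ' η' ξ η => by rw [← inner_sliceR, ← inner_sliceR, h]

theorem ext_sliceL {X Y : HT H K →L[ℂ] HT H K} (h : ∀ η η', sliceL η η' X = sliceL η η' Y) :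
    X = Y := clm_ext_inner fun ξ' η' ξ η => by rw [← inner_sliceL, ← inner_sliceL, h]

theorem sliceR_swap (ξ ξ' : H) (X : HT H K →L[ℂ] HT H K) :
    sliceR ξ ξ' (swap H K ∘L X ∘L swap K H) = sliceL ξ ξ' X := by
  have hs : (swap H K).adjoint = swap K H := clm_ext_inner fun a b c d => by
    rw [ContinuousLinearMap.adjoint_inner_right]; simp [mul_comm]
  ext x
  refine ext_inner_left ℂ fun y => ?_
  rw [inner_sliceR, inner_sliceL]
  simp only [ContinuousLinearMap.comp_apply, swap_tmul]
  rw [← ContinuousLinearMap.adjoint_inner_left, hs, swap_tmul]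

/-- The operator on `(H ⊗ K) ⊗ L` obtained from one on `H ⊗ (K ⊗ L)` by conjugating with the
canonical unitary. -/
def reassoc {L : Type*} [NormedAddCommGroup L] [InnerProductSpace ℂ L]
    (Z : HT H (HT K L) →L[ℂ] HT H (HT K L)) : HT (HT H K) L →L[ℂ] HT (HT H K) L :=
  (assocMap H K L).adjoint ∘L Z ∘L assocMap H K L

theorem inner_reassoc {L : Type*} [NormedAddCommGroup L] [InnerProductSpace ℂ L]
    (Z : HT H (HT K L) →L[ℂ] HT H (HT K L)) (ξ ξ' : H) (η η' : K) (ζ ζ' : L) :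
    inner ℂ (tmul (tmul ξ η) ζ) (reassoc Z (tmul (tmul ξ' η') ζ')) =
      inner ℂ (tmul ξ (tmul η ζ)) (Z (tmul ξ' (tmul η' ζ'))) := by
  simp [reassoc, ContinuousLinearMap.adjoint_inner_right]

end HilbertTensor


section VonNeumann

variable {H K H' : Type*}
  [NormedAddCommGroup H] [InnerProductSpace ℂ H] [CompleteSpace H]
  [NormedAddCommGroup K] [InnerProductSpace ℂ K] [CompleteSpace K]
  [NormedAddCommGroup H'] [InnerProductSpace ℂ H'] [CompleteSpace H']

/-- The commutant of `S ∪ S*`, as a von Neumann algebra. -/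
def commutantOf (S : Set (H →L[ℂ] H)) : VonNeumannAlgebra H where
  toStarSubalgebra := StarSubalgebra.centralizer ℂ S
  centralizer_centralizer' := by simp [Set.centralizer_centralizer_centralizer]

/-- The von Neumann algebra `(S ∪ S*)''` generated by a set of operators. -/
def generatedBy (S : Set (H →L[ℂ] H)) : VonNeumannAlgebra H := (commutantOf S).commutant

theorem mem_commutantOf {S : Set (H →L[ℂ] H)} {T : H →L[ℂ] H} :
    T ∈ commutantOf S ↔ ∀ s ∈ S, s * T = T * s ∧ star s * T = T * star s := by
  rw [← SetLike.mem_coe]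
  exact StarSubalgebra.mem_centralizer_iff ℂ

theorem subset_generatedBy (S : Set (H →L[ℂ] H)) {T : H →L[ℂ] H} (hT : T ∈ S) :
    T ∈ generatedBy S := by
  rw [generatedBy, VonNeumannAlgebra.mem_commutant_iff]
  intro g hg
  exact ((mem_commutantOf.1 hg T hT).1).symm

/-- The von Neumann algebra tensor product `𝓜 ⊗ 𝓝`. -/
def vnTensor (𝓜 : VonNeumannAlgebra H) (𝓝 : VonNeumannAlgebra K) : VonNeumannAlgebra (HT H K) :=
  generatedBy {X | ∃ S ∈ 𝓜, ∃ T ∈ 𝓝, X = opTensor S T}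

theorem opTensor_mem {𝓜 : VonNeumannAlgebra H} {𝓝 : VonNeumannAlgebra K} {S : H →L[ℂ] H}
    {T : K →L[ℂ] K} (hS : S ∈ 𝓜) (hT : T ∈ 𝓝) : opTensor S T ∈ vnTensor 𝓜 𝓝 :=
  subset_generatedBy _ ⟨S, hS, T, hT, rfl⟩

theorem commute_of_mem_vnTensor_right {𝓜 : VonNeumannAlgebra H} {𝓝 : VonNeumannAlgebra K}
    {X : HT H K →L[ℂ] HT H K} (hX : X ∈ vnTensor 𝓜 𝓝) {S : H →L[ℂ] H} (hS : S ∈ 𝓜.commutant) :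
    opTensor S 1 * X = X * opTensor S 1 := by
  rw [vnTensor, generatedBy, VonNeumannAlgebra.mem_commutant_iff] at hX
  refine hX _ (mem_commutantOf.2 ?_)
  rintro _ ⟨A, hA, B, hB, rfl⟩
  rw [VonNeumannAlgebra.mem_commutant_iff] at hS
  rw [star_opTensor, opTensor_mul, opTensor_mul, opTensor_mul, opTensor_mul, hS _ hA,
    hS _ (star_mem hA)]
  simp

theorem commute_of_mem_vnTensor_left {𝓜 : VonNeumannAlgebra H} {𝓝 : VonNeumannAlgebra K}
    {X : HT H K →L[ℂ] HT H K} (hX : X ∈ vnTensor 𝓜 𝓝) {T : K →L[ℂ] K} (hT : T ∈ 𝓝.commutant) :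
    opTensor 1 T * X = X * opTensor 1 T := by
  rw [vnTensor, generatedBy, VonNeumannAlgebra.mem_commutant_iff] at hX
  refine hX _ (mem_commutantOf.2 ?_)
  rintro _ ⟨A, hA, B, hB, rfl⟩
  rw [VonNeumannAlgebra.mem_commutant_iff] at hT
  rw [star_opTensor, opTensor_mul, opTensor_mul, opTensor_mul, opTensor_mul, hT _ hB,
    hT _ (star_mem hB)]
  simp

theorem sliceR_mem {𝓜 : VonNeumannAlgebra H} {𝓝 : VonNeumannAlgebra K}
    {X : HT H K →L[ℂ] HT H K} (hX : X ∈ vnTensor 𝓜 𝓝) (η η' : K) : sliceR η η' X ∈ 𝓜 := by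
  rw [← VonNeumannAlgebra.commutant_commutant 𝓜, VonNeumannAlgebra.mem_commutant_iff]
  intro S hS
  ext ξ'
  refine ext_inner_left ℂ fun ξ => ?_
  have h := commute_of_mem_vnTensor_right hX hS
  have h2 : inner ℂ (tmul ξ η) (opTensor S 1 (X (tmul ξ' η'))) =
      inner ℂ (tmul ξ η) (X (tmul (S ξ') η')) := by
    have h3 := congrArg (fun Z => inner ℂ (tmul ξ η) (Z (tmul ξ' η'))) h
    simpa using h3
  change inner ℂ ξ (S (sliceR η η' X ξ')) = inner ℂ ξ (sliceR η η' X (S ξ'))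
  rw [inner_sliceR, ← h2, ← ContinuousLinearMap.adjoint_inner_left S,
    ← ContinuousLinearMap.adjoint_inner_left (opTensor S 1), inner_sliceR]
  rw [← ContinuousLinearMap.star_eq_adjoint (opTensor S 1), star_opTensor]
  simp [ContinuousLinearMap.star_eq_adjoint]

theorem sliceL_mem {𝓜 : VonNeumannAlgebra H} {𝓝 : VonNeumannAlgebra K}
    {X : HT H K →L[ℂ] HT H K} (hX : X ∈ vnTensor 𝓜 𝓝) (η η' : H) : sliceL η η' X ∈ 𝓝 := by
  rw [← VonNeumannAlgebra.commutant_commutant 𝓝, VonNeumannAlgebra.mem_commutant_iff]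
  intro S hS
  ext ξ'
  refine ext_inner_left ℂ fun ξ => ?_
  have h := commute_of_mem_vnTensor_left hX hS
  have h2 : inner ℂ (tmul η ξ) (opTensor 1 S (X (tmul η' ξ'))) =
      inner ℂ (tmul η ξ) (X (tmul η' (S ξ'))) := by
    have h3 := congrArg (fun Z => inner ℂ (tmul η ξ) (Z (tmul η' ξ'))) h
    simpa using h3
  change inner ℂ ξ (S (sliceL η η' X ξ')) = inner ℂ ξ (sliceL η η' X (S ξ'))
  rw [inner_sliceL, ← h2, ← ContinuousLinearMap.adjoint_inner_left S,
    ← ContinuousLinearMap.adjoint_inner_left (opTensor 1 S), inner_sliceL]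
  rw [← ContinuousLinearMap.star_eq_adjoint (opTensor 1 S), star_opTensor]
  simp [ContinuousLinearMap.star_eq_adjoint]

end VonNeumann

section Amplification

variable {H K H' : Type*}
  [NormedAddCommGroup H] [InnerProductSpace ℂ H] [CompleteSpace H]
  [NormedAddCommGroup K] [InnerProductSpace ℂ K] [CompleteSpace K]
  [NormedAddCommGroup H'] [InnerProductSpace ℂ H'] [CompleteSpace H']

theorem exists_clm_of_bounded_form {E : Type*} [NormedAddCommGroup E] [InnerProductSpace ℂ E]
    (B : E →ₗ⋆[ℂ] E →ₗ[ℂ] ℂ) (C : ℝ) (hB : ∀ x y, ‖B x y‖ ≤ C * ‖x‖ * ‖y‖) :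
    ∃ Y : Completion E →L[ℂ] Completion E,
      ∀ x y : E, inner ℂ (x : Completion E) (Y (y : Completion E)) = B x y := by
  have h1 : ∀ y : E, ∃ z : Completion E, ∀ x : E, inner ℂ (x : Completion E) z = B x y := by
    intro y
    let g : E →L[ℂ] ℂ := LinearMap.mkContinuous
      { toFun := fun x => starRingEnd ℂ (B x y)
        map_add' := fun a b => by simp
        map_smul' := fun c a => by simp } (C * ‖y‖) (fun x => by
          have := hB x y
          simp only [LinearMap.coe_mk, AddHom.coe_mk, RCLike.norm_conj]
          linarith [mul_right_comm C ‖x‖ ‖y‖])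
    refine ⟨(InnerProductSpace.toDual ℂ (Completion E)).symm g.fromCompletion, fun x => ?_⟩
    rw [← inner_conj_symm, InnerProductSpace.toDual_symm_apply,
      ContinuousLinearMap.fromCompletion_apply_coe]
    exact Complex.conj_conj _
  choose z hz using h1
  have hext : ∀ a b : Completion E, (∀ x : E, inner ℂ (x : Completion E) a = inner ℂ (x : Completion E) b) →
      a = b := by
    intro a b h
    refine ext_inner_left ℂ fun v => ?_
    induction v using Completion.induction_on with
    | hp => exact isClosed_eq (by fun_prop) (by fun_prop)
    | ih v => exact h v
  have hbound : ∀ y, ‖z y‖ ≤ |C| * ‖y‖ := by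
    intro y
    have h3 : ∀ v : Completion E, ‖inner ℂ v (z y)‖ ≤ |C| * ‖y‖ * ‖v‖ := by
      intro v
      induction v using Completion.induction_on with
      | hp => exact isClosed_le (by fun_prop) (by fun_prop)
      | ih v =>
        rw [hz, Completion.norm_coe]
        refine (hB v y).trans ?_
        have := mul_le_mul_of_nonneg_right (le_abs_self C) (mul_nonneg (norm_nonneg v) (norm_nonneg y))
        linarith [this, mul_assoc C ‖v‖ ‖y‖, mul_assoc |C| ‖v‖ ‖y‖, mul_right_comm |C| ‖v‖ ‖y‖]
    have h4 := h3 (z y)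
    rw [inner_self_eq_norm_sq_to_K] at h4
    simp only [norm_pow, Complex.norm_real, norm_norm, Complex.coe_algebraMap] at h4
    by_cases h0 : ‖z y‖ = 0
    · rw [h0]; positivity
    · have : 0 < ‖z y‖ := lt_of_le_of_ne (norm_nonneg _) (Ne.symm h0)
      nlinarith
  let T : E →L[ℂ] Completion E := LinearMap.mkContinuous
    { toFun := z
      map_add' := fun a b => hext _ _ fun x => by rw [inner_add_right, hz, hz, hz, map_add]
      map_smul' := fun c a => hext _ _ fun x => by
        rw [RingHom.id_apply, inner_smul_right, hz, hz, map_smul, smul_eq_mul] } |C| hbound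
  refine ⟨T.fromCompletion, fun x y => ?_⟩
  rw [ContinuousLinearMap.fromCompletion_apply_coe]
  exact hz y x

theorem opTensor_sum_left {ι : Type*} (s : Finset ι) (f : ι → H →L[ℂ] H) (T : K →L[ℂ] K) :
    opTensor (∑ i ∈ s, f i) T = ∑ i ∈ s, opTensor (f i) T :=
  clm_ext fun ξ η => by simp [tmul_sum_left]

theorem opTensor_add_left (S S' : H →L[ℂ] H) (T : K →L[ℂ] K) :
    opTensor (S + S') T = opTensor S T + opTensor S' T :=
  clm_ext fun ξ η => by simp [add_tmul]

theorem opTensor_smul_left (c : ℂ) (S : H →L[ℂ] H) (T : K →L[ℂ] K) :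
    opTensor (c • S) T = c • opTensor S T :=
  clm_ext fun ξ η => by simp [smul_tmul]

theorem opTensor_smul_right (c : ℂ) (S : H →L[ℂ] H) (T : K →L[ℂ] K) :
    opTensor S (c • T) = c • opTensor S T :=
  clm_ext fun ξ η => by simp [tmul_smul]

theorem sliceR_add_left (η₁ η₂ η' : K) (X : HT H K →L[ℂ] HT H K) :
    sliceR (η₁ + η₂) η' X = sliceR η₁ η' X + sliceR η₂ η' X := by
  ext x; refine ext_inner_left ℂ fun y => ?_
  simp [inner_sliceR, tmul_add, inner_add_left, inner_add_right]

theorem sliceR_add_right (η η₁ η₂ : K) (X : HT H K →L[ℂ] HT H K) :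
    sliceR η (η₁ + η₂) X = sliceR η η₁ X + sliceR η η₂ X := by
  ext x; refine ext_inner_left ℂ fun y => ?_
  simp [inner_sliceR, tmul_add, inner_add_right]

theorem sliceR_smul_left (c : ℂ) (η η' : K) (X : HT H K →L[ℂ] HT H K) :
    sliceR (c • η) η' X = starRingEnd ℂ c • sliceR η η' X := by
  ext x; refine ext_inner_left ℂ fun y => ?_
  simp [inner_sliceR, tmul_smul, inner_smul_left, inner_smul_right]

theorem sliceR_smul_right (c : ℂ) (η η' : K) (X : HT H K →L[ℂ] HT H K) :
    sliceR η (c • η') X = c • sliceR η η' X := by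
  ext x; refine ext_inner_left ℂ fun y => ?_
  simp [inner_sliceR, tmul_smul, inner_smul_right]

/-- The homomorphism `[x i j] ↦ ∑ ψ (x i j) ⊗ |e i⟩⟨e j|`. -/
def matrixHom {A : Type*} [CStarAlgebra A] (ψ : A →⋆ₐ[ℂ] (H →L[ℂ] H)) {n : ℕ}
    (e : Fin n → K) (he : Orthonormal ℂ e) :
    CStarMatrix (Fin n) (Fin n) A →⋆ₙₐ[ℂ] (HT H K →L[ℂ] HT H K) where
  toFun x := ∑ i, ∑ j, opTensor (ψ (x i j)) (InnerProductSpace.rankOne ℂ (e i) (e j))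
  map_smul' c x := by
    simp [Finset.smul_sum, opTensor_smul_left]
  map_zero' := by
    have h0 : ∀ T : K →L[ℂ] K, opTensor (0 : H →L[ℂ] H) T = 0 := fun T => by
      simpa using opTensor_smul_left (0 : ℂ) (0 : H →L[ℂ] H) T
    simp [h0]
  map_add' x y := by
    simp [opTensor_add_left, Finset.sum_add_distrib]
  map_mul' x y := by
    have hr : ∀ i j k l, InnerProductSpace.rankOne ℂ (e i) (e j) *
        InnerProductSpace.rankOne ℂ (e k) (e l) =
        if j = k then InnerProductSpace.rankOne ℂ (e i) (e l) else 0 := by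
      intro i j k l
      rw [ContinuousLinearMap.mul_def, InnerProductSpace.rankOne_comp_rankOne,
        orthonormal_iff_ite.1 he]
      split_ifs <;> simp
    have h0 : ∀ S : H →L[ℂ] H, opTensor S (0 : K →L[ℂ] K) = 0 := fun S => by
      simpa using opTensor_smul_right (0 : ℂ) S (0 : K →L[ℂ] K)
    simp only [CStarMatrix.mul_apply, map_sum, map_mul, opTensor_sum_left,
      Finset.mul_sum, Finset.sum_mul, opTensor_mul, hr]
    simp only [apply_ite (opTensor _), h0]
    simp only [Finset.sum_ite_eq', Finset.mem_univ, if_true]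
    rw [Finset.sum_comm]
    conv_rhs => rw [Finset.sum_comm]
    exact Finset.sum_congr rfl fun j _ => Finset.sum_comm
  map_star' x := by
    simp only [CStarMatrix.star_apply, map_star]
    refine Eq.trans ?_ (star_sum (R := HT H K →L[ℂ] HT H K) Finset.univ _).symm
    rw [Finset.sum_comm]
    refine Finset.sum_congr rfl fun i _ => ?_
    refine Eq.trans ?_ (star_sum (R := HT H K →L[ℂ] HT H K) Finset.univ _).symm
    refine Finset.sum_congr rfl fun j _ => ?_
    rw [star_opTensor,
      ContinuousLinearMap.star_eq_adjoint (InnerProductSpace.rankOne ℂ (e i) (e j)),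
      InnerProductSpace.adjoint_rankOne]

theorem inner_matrixHom {A : Type*} [CStarAlgebra A] (ψ : A →⋆ₐ[ℂ] (H →L[ℂ] H)) {n : ℕ}
    (e : Fin n → K) (he : Orthonormal ℂ e) (x : CStarMatrix (Fin n) (Fin n) A) (ξ ξ' : H)
    (η η' : K) : inner ℂ (tmul ξ η) (matrixHom ψ e he x (tmul ξ' η')) =
      ∑ i, ∑ j, inner ℂ ξ (ψ (x i j) ξ') * (inner ℂ (e j) η' * inner ℂ η (e i)) := by
  change inner ℂ (tmul ξ η) ((∑ i, ∑ j, opTensor (ψ (x i j))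
    (InnerProductSpace.rankOne ℂ (e i) (e j))) (tmul ξ' η')) = _
  simp [sum_apply, inner_sum]

theorem exists_orthonormal_repr (u v : H ⊗[ℂ] K) :
    ∃ (n : ℕ) (e : Fin n → K) (a b : Fin n → H), Orthonormal ℂ e ∧
      u = ∑ i, a i ⊗ₜ e i ∧ v = ∑ i, b i ⊗ₜ e i := by
  obtain ⟨E', F', -, hF, huv⟩ := TensorProduct.exists_finite_submodule_of_setFinite
    ({u, v} : Set (H ⊗[ℂ] K)) (by simp)
  have key : ∀ w ∈ LinearMap.range (mapIncl E' F'), ∃ a : Fin (Module.finrank ℂ F') → H,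
      w = ∑ i, a i ⊗ₜ ((stdOrthonormalBasis ℂ F' i : F') : K) := by
    rintro _ ⟨w, rfl⟩
    induction w using TensorProduct.induction_on with
    | zero => exact ⟨0, by simp⟩
    | tmul x y =>
      refine ⟨fun i => (inner ℂ (stdOrthonormalBasis ℂ F' i) y : ℂ) • (x : H), ?_⟩
      have := (stdOrthonormalBasis ℂ F').sum_repr' y
      have h2 : (y : K) = ∑ i, (inner ℂ (stdOrthonormalBasis ℂ F' i) y : ℂ) •
          ((stdOrthonormalBasis ℂ F' i : F') : K) := by
        conv_lhs => rw [← this]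
        simp
      simp only [mapIncl, map_tmul, Submodule.subtype_apply]
      conv_lhs => rw [h2]
      simp [TensorProduct.tmul_sum, TensorProduct.smul_tmul]
    | add x y hx hy =>
      obtain ⟨a, ha⟩ := hx
      obtain ⟨b, hb⟩ := hy
      exact ⟨a + b, by rw [map_add, ha, hb]; simp [TensorProduct.add_tmul, Finset.sum_add_distrib]⟩
  obtain ⟨a, ha⟩ := key u (huv (by simp))
  obtain ⟨b, hb⟩ := key v (huv (by simp))
  refine ⟨_, _, a, b, ?_, ha, hb⟩
  exact (stdOrthonormalBasis ℂ F').orthonormal.comp_linearIsometry F'.subtypeₗᵢ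

instance isClosed_vn (𝓜 : VonNeumannAlgebra H) :
    IsClosed (𝓜.toStarSubalgebra : Set (H →L[ℂ] H)) := by
  have := 𝓜.centralizer_centralizer
  rw [VonNeumannAlgebra.coe_toStarSubalgebra, ← this]
  exact Set.isClosed_centralizer _

theorem inner_matrixSum {A : Type*} (φ : A → (H →L[ℂ] H)) {n : ℕ} (x : Fin n → Fin n → A)
    (e : Fin n → K) (he : Orthonormal ℂ e) (a b : Fin n → H) :
    inner ℂ (∑ i, tmul (b i) (e i)) ((∑ i, ∑ j, opTensor (φ (x i j))
      (InnerProductSpace.rankOne ℂ (e i) (e j))) (∑ i, tmul (a i) (e i))) =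
      ∑ i, ∑ j, inner ℂ (b i) (φ (x i j) (a j)) := by
  have h : (∑ i, ∑ j, opTensor (φ (x i j)) (InnerProductSpace.rankOne ℂ (e i) (e j)))
      (∑ i, tmul (a i) (e i)) = ∑ i, ∑ j, tmul (φ (x i j) (a j)) (e i) := by
    simp only [map_sum, sum_apply, opTensor_tmul, InnerProductSpace.rankOne_apply,
      orthonormal_iff_ite.1 he, ite_smul, one_smul, zero_smul]
    rw [Finset.sum_comm]
    refine Finset.sum_congr rfl fun i _ => ?_
    rw [Finset.sum_comm]
    refine Finset.sum_congr rfl fun j _ => ?_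
    refine (Finset.sum_eq_single j (fun k _ hk => ?_) (by simp)).trans (by simp)
    rw [if_neg (Ne.symm hk)]
    exact map_zero (leftLeg _)
  rw [h]
  simp [sum_inner, inner_sum, orthonormal_iff_ite.1 he]

theorem norm_matrixHom_le (𝓜 : VonNeumannAlgebra H)
    (φ : 𝓜.toStarSubalgebra →⋆ₐ[ℂ] (H' →L[ℂ] H')) (X : HT H K →L[ℂ] HT H K)
    (hX : ∀ η η', sliceR η η' X ∈ 𝓜) {n : ℕ} (e : Fin n → K) (he : Orthonormal ℂ e)
    (u v : HT H' K) :
    ‖inner ℂ v ((∑ i, ∑ j, opTensor (φ ⟨sliceR (e i) (e j) X, hX _ _⟩)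
      (InnerProductSpace.rankOne ℂ (e i) (e j))) u)‖ ≤ ‖X‖ * ‖v‖ * ‖u‖ := by
  let _ : PartialOrder 𝓜.toStarSubalgebra := CStarAlgebra.spectralOrder _
  have _ : StarOrderedRing 𝓜.toStarSubalgebra := CStarAlgebra.spectralOrderedRing _
  let x : CStarMatrix (Fin n) (Fin n) 𝓜.toStarSubalgebra :=
    CStarMatrix.ofMatrix (Matrix.of fun i j => ⟨sliceR (e i) (e j) X, hX _ _⟩)
  have h1 := NonUnitalStarAlgHom.norm_apply_le (matrixHom φ e he) x
  have h2 := NonUnitalStarAlgHom.norm_map (matrixHom (𝓜.toStarSubalgebra.subtype) e he) (by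
    intro y z hyz
    ext i j ξ'
    refine ext_inner_left ℂ fun ξ => ?_
    have h := congrArg (fun Z => inner ℂ (tmul ξ (e i)) (Z (tmul ξ' (e j)))) hyz
    simp only [inner_matrixHom, orthonormal_iff_ite.1 he] at h
    simpa using h) x
  have h3 : ‖matrixHom (𝓜.toStarSubalgebra.subtype) e he x‖ ≤ ‖X‖ := by
    set P : K →L[ℂ] K := ∑ i, InnerProductSpace.rankOne ℂ (e i) (e i) with hP
    have hPa : ∀ η, P η = ∑ i, (inner ℂ (e i) η : ℂ) • e i := fun η => by
      simp [hP, sum_apply]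
    have hPn : ‖P‖ ≤ 1 := by
      refine ContinuousLinearMap.opNorm_le_bound _ zero_le_one fun η => ?_
      rw [one_mul]
      refine (sq_le_sq₀ (norm_nonneg _) (norm_nonneg _)).1 ?_
      refine le_trans (le_of_eq ?_) (he.sum_inner_products_le (s := Finset.univ) η)
      rw [hPa, ← RCLike.ofReal_inj (K := ℂ), RCLike.ofReal_pow, ← inner_self_eq_norm_sq_to_K,
        he.inner_sum]
      push_cast
      exact Finset.sum_congr rfl fun i _ => RCLike.conj_mul _
    have hx : matrixHom (𝓜.toStarSubalgebra.subtype) e he x =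
        (opTensor 1 P).adjoint ∘L X ∘L opTensor 1 P := by
      refine clm_ext_inner fun ξ η ξ' η' => ?_
      rw [inner_matrixHom, ContinuousLinearMap.comp_apply,
        ContinuousLinearMap.adjoint_inner_right, ContinuousLinearMap.comp_apply,
        opTensor_tmul, opTensor_tmul, hPa, hPa, tmul_sum_right, tmul_sum_right]
      simp only [tmul_smul, map_sum, map_smul, sum_inner, inner_sum, inner_smul_left,
        inner_smul_right, inner_conj_symm]
      simp only [Finset.mul_sum]
      rw [Finset.sum_comm]
      refine Finset.sum_congr rfl fun i _ => Finset.sum_congr rfl fun j _ => ?_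
      change inner ℂ ξ (sliceR (e j) (e i) X ξ') * _ = _
      rw [inner_sliceR]
      change _ = _ * (_ * inner ℂ (tmul ξ (e j)) (X (tmul ξ' (e i))))
      ring
    have hn : ‖opTensor (1 : H →L[ℂ] H) P‖ ≤ 1 :=
      (norm_opTensor_le _ _).trans (mul_le_one₀ ContinuousLinearMap.norm_id_le (norm_nonneg _) hPn)
    rw [hx]
    refine (ContinuousLinearMap.opNorm_comp_le _ _).trans ?_
    have h5 := ContinuousLinearMap.opNorm_comp_le X (opTensor (1 : H →L[ℂ] H) P)
    rw [LinearIsometryEquiv.norm_map]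
    nlinarith [norm_nonneg X, norm_nonneg (opTensor (1 : H →L[ℂ] H) P),
      norm_nonneg (X ∘L opTensor (1 : H →L[ℂ] H) P)]
  have h4 : ‖matrixHom φ e he x‖ ≤ ‖X‖ := h1.trans (h2 ▸ h3)
  change ‖inner ℂ v (matrixHom φ e he x u)‖ ≤ _
  refine (norm_inner_le_norm _ _).trans ?_
  have := (matrixHom φ e he x).le_of_opNorm_le h4 u
  nlinarith [norm_nonneg v]

/-- Existence of `(φ ⊗ id)(X)`: the operator whose slices are `φ` of the slices of `X`. -/
theorem exists_amplification (𝓜 : VonNeumannAlgebra H)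
    (φ : 𝓜.toStarSubalgebra →⋆ₐ[ℂ] (H' →L[ℂ] H')) (X : HT H K →L[ℂ] HT H K)
    (hX : ∀ η η', sliceR η η' X ∈ 𝓜) :
    ∃ Y : HT H' K →L[ℂ] HT H' K, ∀ η η', sliceR η η' Y = φ ⟨sliceR η η' X, hX η η'⟩ := by
  have hadd₁ : ∀ η₁ η₂ η', φ ⟨sliceR (η₁ + η₂) η' X, hX _ _⟩ =
      φ ⟨sliceR η₁ η' X, hX _ _⟩ + φ ⟨sliceR η₂ η' X, hX _ _⟩ := fun η₁ η₂ η' => by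
    rw [← map_add]; exact congrArg φ (Subtype.ext (sliceR_add_left _ _ _ _))
  have hadd₂ : ∀ η η₁ η₂, φ ⟨sliceR η (η₁ + η₂) X, hX _ _⟩ =
      φ ⟨sliceR η η₁ X, hX _ _⟩ + φ ⟨sliceR η η₂ X, hX _ _⟩ := fun η₁ η₂ η' => by
    rw [← map_add]; exact congrArg φ (Subtype.ext (sliceR_add_right _ _ _ _))
  have hsmul₁ : ∀ (c : ℂ) η η', φ ⟨sliceR (c • η) η' X, hX _ _⟩ =
      starRingEnd ℂ c • φ ⟨sliceR η η' X, hX _ _⟩ := fun c η η' => by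
    rw [← map_smul]; exact congrArg φ (Subtype.ext (sliceR_smul_left _ _ _ _))
  have hsmul₂ : ∀ (c : ℂ) η η', φ ⟨sliceR η (c • η') X, hX _ _⟩ =
      c • φ ⟨sliceR η η' X, hX _ _⟩ := fun c η η' => by
    rw [← map_smul]; exact congrArg φ (Subtype.ext (sliceR_smul_right _ _ _ _))
  let B₀ : H' → K → H' ⊗[ℂ] K →ₗ[ℂ] ℂ := fun ζ' η' => TensorProduct.lift
    (LinearMap.mk₂ ℂ (fun ζ η => (inner ℂ ζ' (φ ⟨sliceR η' η X, hX _ _⟩ ζ) : ℂ))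
      (fun a b η => by simp)
      (fun c a η => by simp)
      (fun a η₁ η₂ => by simp [hadd₂])
      (fun c a η => by simp [hsmul₂]))
  have hB₀ : ∀ ζ' η' ζ η, B₀ ζ' η' (ζ ⊗ₜ η) = inner ℂ ζ' (φ ⟨sliceR η' η X, hX _ _⟩ ζ) :=
    fun _ _ _ _ => rfl
  let B : H' ⊗[ℂ] K →ₗ⋆[ℂ] H' ⊗[ℂ] K →ₗ[ℂ] ℂ := TensorProduct.lift
    (LinearMap.mk₂'ₛₗ (starRingEnd ℂ) (starRingEnd ℂ) B₀
      (fun a b η => TensorProduct.ext' fun x y => by simp [hB₀])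
      (fun c a η => TensorProduct.ext' fun x y => by simp [hB₀, mul_comm])
      (fun a η₁ η₂ => TensorProduct.ext' fun x y => by simp [hB₀, hadd₁])
      (fun c a η => TensorProduct.ext' fun x y => by simp [hB₀, hsmul₁]))
  have hB : ∀ ζ' η' ζ η, B (ζ' ⊗ₜ η') (ζ ⊗ₜ η) = inner ℂ ζ' (φ ⟨sliceR η' η X, hX _ _⟩ ζ) :=
    fun _ _ _ _ => rfl
  obtain ⟨Y, hY⟩ := exists_clm_of_bounded_form B ‖X‖ (fun v u => by
    obtain ⟨n, e, b, a, he, rfl, rfl⟩ := exists_orthonormal_repr v u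
    have h := norm_matrixHom_le 𝓜 φ X hX e he
      ((∑ i, a i ⊗ₜ[ℂ] e i : H' ⊗[ℂ] K) : HT H' K) ((∑ i, b i ⊗ₜ[ℂ] e i : H' ⊗[ℂ] K) : HT H' K)
    rw [Completion.norm_coe, Completion.norm_coe] at h
    refine le_of_eq_of_le ?_ h
    congr 1
    have hc : ∀ f : Fin n → H', ((∑ i, f i ⊗ₜ[ℂ] e i : H' ⊗[ℂ] K) : HT H' K) =
        ∑ i, tmul (f i) (e i) := fun f =>
      map_sum (Completion.toComplL (𝕜 := ℂ) (E := H' ⊗[ℂ] K)) (fun i => f i ⊗ₜ[ℂ] e i) Finset.univ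
    rw [hc, hc, inner_matrixSum φ (fun i j => ⟨sliceR (e i) (e j) X, hX _ _⟩) e he]
    simp only [map_sum, LinearMap.sum_apply, hB]
    exact Finset.sum_comm)
  refine ⟨Y, fun η' η => ?_⟩
  ext x
  refine ext_inner_left ℂ fun y => ?_
  rw [inner_sliceR, ← hB]
  exact hY _ _

end Amplification


section Morphisms

variable {H K H' : Type*}
  [NormedAddCommGroup H] [InnerProductSpace ℂ H] [CompleteSpace H]
  [NormedAddCommGroup K] [InnerProductSpace ℂ K] [CompleteSpace K]
  [NormedAddCommGroup H'] [InnerProductSpace ℂ H'] [CompleteSpace H']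

theorem coe_mem_vn (𝓜 : VonNeumannAlgebra H) (x : 𝓜.toStarSubalgebra) :
    (x : H →L[ℂ] H) ∈ 𝓜 := x.2

/-- An operator in `𝓜` as an element of the underlying `*`-algebra. -/
def elem (𝓜 : VonNeumannAlgebra H) (T : H →L[ℂ] H) (hT : T ∈ 𝓜) : 𝓜.toStarSubalgebra := ⟨T, hT⟩

theorem sliceR_mem' {𝓜 : VonNeumannAlgebra H} {𝓝 : VonNeumannAlgebra K}
    (X : (vnTensor 𝓜 𝓝).toStarSubalgebra) (η η' : K) :
    sliceR η η' (X : HT H K →L[ℂ] HT H K) ∈ 𝓜 := sliceR_mem (coe_mem_vn (vnTensor 𝓜 𝓝) X) η η'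

theorem sliceL_mem' {𝓜 : VonNeumannAlgebra H} {𝓝 : VonNeumannAlgebra K}
    (X : (vnTensor 𝓜 𝓝).toStarSubalgebra) (ξ ξ' : H) :
    sliceL ξ ξ' (X : HT H K →L[ℂ] HT H K) ∈ 𝓝 := sliceL_mem (coe_mem_vn (vnTensor 𝓜 𝓝) X) ξ ξ'

/-- Unital `*`-homomorphisms between von Neumann algebras. -/
abbrev VNHom (𝓜 : VonNeumannAlgebra H) (𝓝 : VonNeumannAlgebra H') : Type _ :=
  𝓜.toStarSubalgebra →⋆ₐ[ℂ] 𝓝.toStarSubalgebra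

/-- The σ-weak topology on `B(H)`: the coarsest one for which all functionals
`T ↦ ∑ₙ ⟪ξₙ, T ηₙ⟫` with `∑ₙ ‖ξₙ‖² < ∞` and `∑ₙ ‖ηₙ‖² < ∞` are continuous. -/
@[reducible] def sigmaWeak (H : Type*) [NormedAddCommGroup H] [InnerProductSpace ℂ H] :
    TopologicalSpace (H →L[ℂ] H) :=
  ⨅ p : lp (fun _ : ℕ => H) 2 × lp (fun _ : ℕ => H) 2,
    TopologicalSpace.induced (fun T : H →L[ℂ] H => ∑' n, (inner ℂ (p.1 n) (T (p.2 n)) : ℂ))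
      inferInstance

/-- The homomorphism is normal, that is, σ-weakly continuous. -/
def IsNormal {𝓜 : VonNeumannAlgebra H} {𝓝 : VonNeumannAlgebra H'} (φ : VNHom 𝓜 𝓝) : Prop :=
  @Continuous 𝓜.toStarSubalgebra 𝓝.toStarSubalgebra
    (TopologicalSpace.induced Subtype.val (sigmaWeak H))
    (TopologicalSpace.induced Subtype.val (sigmaWeak H')) φ

/-- `φ ⊗ id` on the von Neumann algebra tensor product `𝓜 ⊗ 𝓐`. It is the operator whose slices
are `(id ⊗ ω)((φ ⊗ id)(X)) = φ((id ⊗ ω)(X))` for all vector functionals `ω`; for normal `φ` this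
is the normal extension of `x ⊗ a ↦ φ(x) ⊗ a`. -/
def tensorId {𝓜 : VonNeumannAlgebra H} {𝓝 : VonNeumannAlgebra H'} (φ : VNHom 𝓜 𝓝)
    (𝓐 : VonNeumannAlgebra K) (X : (vnTensor 𝓜 𝓐).toStarSubalgebra) :
    HT H' K →L[ℂ] HT H' K :=
  Classical.choose (exists_amplification 𝓜 (𝓝.toStarSubalgebra.subtype.comp φ)
    (X : HT H K →L[ℂ] HT H K) (sliceR_mem' X))

theorem sliceR_tensorId {𝓜 : VonNeumannAlgebra H} {𝓝 : VonNeumannAlgebra H'} (φ : VNHom 𝓜 𝓝)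
    (𝓐 : VonNeumannAlgebra K) (X : (vnTensor 𝓜 𝓐).toStarSubalgebra) (η η' : K) :
    sliceR η η' (tensorId φ 𝓐 X) =
      (φ (elem 𝓜 (sliceR η η' (X : HT H K →L[ℂ] HT H K)) (sliceR_mem' X η η')) : H' →L[ℂ] H') :=
  Classical.choose_spec (exists_amplification 𝓜 (𝓝.toStarSubalgebra.subtype.comp φ)
    (X : HT H K →L[ℂ] HT H K) (sliceR_mem' X)) η η'

theorem tensorId_opTensor {𝓜 : VonNeumannAlgebra H} {𝓝 : VonNeumannAlgebra H'} (φ : VNHom 𝓜 𝓝)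
    (𝓐 : VonNeumannAlgebra K) (x : 𝓜.toStarSubalgebra) (a : 𝓐.toStarSubalgebra) :
    tensorId φ 𝓐 (elem (vnTensor 𝓜 𝓐) (opTensor (x : H →L[ℂ] H) (a : K →L[ℂ] K))
      (opTensor_mem (coe_mem_vn 𝓜 x) (coe_mem_vn 𝓐 a))) =
      opTensor (φ x : H' →L[ℂ] H') (a : K →L[ℂ] K) := by
  refine ext_sliceR fun η η' => ?_
  rw [sliceR_tensorId, sliceR_opTensor]
  have h : elem 𝓜 (sliceR η η' (opTensor (x : H →L[ℂ] H) (a : K →L[ℂ] K)))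
      (sliceR_mem (opTensor_mem (coe_mem_vn 𝓜 x) (coe_mem_vn 𝓐 a)) η η') =
      (inner ℂ η ((a : K →L[ℂ] K) η') : ℂ) • x := Subtype.ext (sliceR_opTensor _ _ _ _)
  have h2 := congrArg (fun y => (φ y : H' →L[ℂ] H')) h
  simp only [map_smul] at h2
  exact h2

theorem exists_amplificationL (𝓐 : VonNeumannAlgebra K)
    (φ : 𝓐.toStarSubalgebra →⋆ₐ[ℂ] (H' →L[ℂ] H')) (X : HT H K →L[ℂ] HT H K)
    (hX : ∀ ξ ξ', sliceL ξ ξ' X ∈ 𝓐) :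
    ∃ Y : HT H H' →L[ℂ] HT H H', ∀ ξ ξ', sliceL ξ ξ' Y = φ ⟨sliceL ξ ξ' X, hX ξ ξ'⟩ := by
  obtain ⟨Y, hY⟩ := exists_amplification 𝓐 φ (swap H K ∘L X ∘L swap K H)
    (fun ξ ξ' => by rw [sliceR_swap]; exact hX ξ ξ')
  refine ⟨swap H' H ∘L Y ∘L swap H H', fun ξ ξ' => ?_⟩
  have hss : swap H H' ∘L (swap H' H ∘L Y ∘L swap H H') ∘L swap H' H = Y := by
    have h1 : swap H H' ∘L swap H' H = .id ℂ _ := clm_ext fun a b => by simp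
    calc _ = (swap H H' ∘L swap H' H) ∘L Y ∘L (swap H H' ∘L swap H' H) := rfl
      _ = Y := by rw [h1]; simp
  rw [← sliceR_swap, hss, hY]
  exact congrArg φ (Subtype.ext (sliceR_swap _ _ _))

/-- `id ⊗ φ` on the von Neumann algebra tensor product `𝓜 ⊗ 𝓐`. It is the operator whose slices
are `(ω ⊗ id)((id ⊗ φ)(X)) = φ((ω ⊗ id)(X))` for all vector functionals `ω`; for normal `φ` this
is the normal extension of `x ⊗ a ↦ x ⊗ φ(a)`. -/
def idTensor (𝓜 : VonNeumannAlgebra H) {𝓐 : VonNeumannAlgebra K} {𝓝 : VonNeumannAlgebra H'}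
    (φ : VNHom 𝓐 𝓝) (X : (vnTensor 𝓜 𝓐).toStarSubalgebra) : HT H H' →L[ℂ] HT H H' :=
  Classical.choose (exists_amplificationL 𝓐 (𝓝.toStarSubalgebra.subtype.comp φ)
    (X : HT H K →L[ℂ] HT H K) (sliceL_mem' X))

theorem sliceL_idTensor (𝓜 : VonNeumannAlgebra H) {𝓐 : VonNeumannAlgebra K}
    {𝓝 : VonNeumannAlgebra H'} (φ : VNHom 𝓐 𝓝) (X : (vnTensor 𝓜 𝓐).toStarSubalgebra)
    (ξ ξ' : H) : sliceL ξ ξ' (idTensor 𝓜 φ X) =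
      (φ (elem 𝓐 (sliceL ξ ξ' (X : HT H K →L[ℂ] HT H K)) (sliceL_mem' X ξ ξ')) : H' →L[ℂ] H') :=
  Classical.choose_spec (exists_amplificationL 𝓐 (𝓝.toStarSubalgebra.subtype.comp φ)
    (X : HT H K →L[ℂ] HT H K) (sliceL_mem' X)) ξ ξ'

/-- A von Neumann algebra is finite if every isometry in it is unitary. -/
def IsFinite (𝓜 : VonNeumannAlgebra H) : Prop :=
  ∀ v ∈ 𝓜, star v * v = 1 → v * star v = 1

/-- A von Neumann algebra is a factor if its center consists of the scalars. -/
def IsFactor (𝓜 : VonNeumannAlgebra H) : Prop :=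
  ∀ z ∈ 𝓜, z ∈ 𝓜.commutant → ∃ c : ℂ, z = c • (1 : H →L[ℂ] H)

end Morphisms

section Kac

/-- A compact Kac algebra `(A, δ, h)`, with `A` acting on the GNS space `K` of `h` and with GNS
cyclic vector `Ω`, so that `h(a) = ⟪Ω, a Ω⟫`. -/
structure CompactKacAlgebra (K : Type*) [NormedAddCommGroup K] [InnerProductSpace ℂ K]
    [CompleteSpace K] where
  alg : VonNeumannAlgebra K
  Ω : K
  norm_Ω : ‖Ω‖ = 1
  cyclic : Dense {η : K | ∃ a ∈ alg, η = a Ω}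
  /-- The state `h` is faithful. -/
  faithful : ∀ a ∈ alg, inner ℂ Ω ((star a * a) Ω) = 0 → a = 0
  /-- The state `h` is tracial. -/
  tracial : ∀ a ∈ alg, ∀ b ∈ alg, inner ℂ Ω ((a * b) Ω) = inner ℂ Ω ((b * a) Ω)
  /-- The coproduct. -/
  δ : VNHom alg (vnTensor alg alg)
  δ_injective : Function.Injective δ
  δ_normal : IsNormal δ
  /-- `(δ ⊗ id) δ = (id ⊗ δ) δ` -/
  coassoc : ∀ a, tensorId δ alg (δ a) = reassoc (idTensor alg δ (δ a))
  /-- `(id ⊗ h)(δ(a)) = h(a) 1` -/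
  invariant_right : ∀ a : alg.toStarSubalgebra,
    sliceR Ω Ω (δ a : HT K K →L[ℂ] HT K K) = (inner ℂ Ω ((a : K →L[ℂ] K) Ω) : ℂ) • 1
  /-- `(h ⊗ id)(δ(a)) = h(a) 1` -/
  invariant_left : ∀ a : alg.toStarSubalgebra,
    sliceL Ω Ω (δ a : HT K K →L[ℂ] HT K K) = (inner ℂ Ω ((a : K →L[ℂ] K) Ω) : ℂ) • 1

namespace CompactKacAlgebra

variable {K : Type*} [NormedAddCommGroup K] [InnerProductSpace ℂ K] [CompleteSpace K]
  (𝔾 : CompactKacAlgebra K)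

/-- The linear map `a ⊗ b ↦ aΩ ⊗ bΩ`. -/
def gnsMap : 𝔾.alg.toStarSubalgebra ⊗[ℂ] 𝔾.alg.toStarSubalgebra →ₗ[ℂ] HT K K :=
  TensorProduct.lift (LinearMap.mk₂ ℂ
    (fun a b : 𝔾.alg.toStarSubalgebra => tmul ((a : K →L[ℂ] K) 𝔾.Ω) ((b : K →L[ℂ] K) 𝔾.Ω))
    (fun a b c => by simp [add_tmul])
    (fun c a b => by simp [smul_tmul])
    (fun a b c => by simp [tmul_add])
    (fun c a b => by simp [tmul_smul]))

/-- The linear map `a ⊗ b ↦ δ(b)(aΩ ⊗ Ω)`. -/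
def coprodMap : 𝔾.alg.toStarSubalgebra ⊗[ℂ] 𝔾.alg.toStarSubalgebra →ₗ[ℂ] HT K K :=
  TensorProduct.lift (LinearMap.mk₂ ℂ
    (fun a b : 𝔾.alg.toStarSubalgebra =>
      (𝔾.δ b : HT K K →L[ℂ] HT K K) (tmul ((a : K →L[ℂ] K) 𝔾.Ω) 𝔾.Ω))
    (fun a b c => by simp [add_tmul])
    (fun c a b => by simp [smul_tmul])
    (fun a b c => by simp)
    (fun c a b => by simp))

/-- The adjoint `V*` of the multiplicative unitary, the continuous extension of
`aΩ ⊗ bΩ ↦ δ(b)(aΩ ⊗ Ω)`. -/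
def Vstar : HT K K →L[ℂ] HT K K := 𝔾.coprodMap.extendOfNorm 𝔾.gnsMap

theorem denseRange_gnsMap : DenseRange 𝔾.gnsMap := by
  have hcyc : ∀ S : Submodule ℂ K, IsClosed (S : Set K) →
      (∀ a : 𝔾.alg.toStarSubalgebra, (a : K →L[ℂ] K) 𝔾.Ω ∈ S) → ∀ η, η ∈ S := by
    intro S hS h η
    refine hS.closure_subset_iff.2 ?_ (𝔾.cyclic η)
    rintro _ ⟨a, ha, rfl⟩
    exact h ⟨a, ha⟩
  have hcl := Submodule.isClosed_topologicalClosure (LinearMap.range 𝔾.gnsMap)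
  have key := submodule_eq_top _ hcl (fun ξ η =>
    hcyc ((LinearMap.range 𝔾.gnsMap).topologicalClosure.comap (rightLeg η).toLinearMap)
      (hcl.preimage (rightLeg η).continuous) (fun a =>
        hcyc ((LinearMap.range 𝔾.gnsMap).topologicalClosure.comap
          (leftLeg ((a : K →L[ℂ] K) 𝔾.Ω)).toLinearMap)
          (hcl.preimage (leftLeg _).continuous)
          (fun b => Submodule.le_topologicalClosure _ ⟨a ⊗ₜ b, rfl⟩) η) ξ)
  intro x
  have hx : x ∈ (LinearMap.range 𝔾.gnsMap).topologicalClosure := key ▸ Submodule.mem_top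
  exact hx

theorem inner_coprodMap (x y : 𝔾.alg.toStarSubalgebra ⊗[ℂ] 𝔾.alg.toStarSubalgebra) :
    inner ℂ (𝔾.coprodMap x) (𝔾.coprodMap y) = inner ℂ (𝔾.gnsMap x) (𝔾.gnsMap y) := by
  induction x using TensorProduct.induction_on with
  | zero => simp
  | add x x' hx hx' => simp only [map_add, inner_add_left, hx, hx']
  | tmul a b =>
    induction y using TensorProduct.induction_on with
    | zero => simp
    | add y y' hy hy' => simp only [map_add, inner_add_right, hy, hy']
    | tmul c d =>
      change inner ℂ ((𝔾.δ b : HT K K →L[ℂ] HT K K) (tmul ((a : K →L[ℂ] K) 𝔾.Ω) 𝔾.Ω))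
        ((𝔾.δ d : HT K K →L[ℂ] HT K K) (tmul ((c : K →L[ℂ] K) 𝔾.Ω) 𝔾.Ω)) =
        inner ℂ (tmul ((a : K →L[ℂ] K) 𝔾.Ω) ((b : K →L[ℂ] K) 𝔾.Ω))
          (tmul ((c : K →L[ℂ] K) 𝔾.Ω) ((d : K →L[ℂ] K) 𝔾.Ω))
      rw [← ContinuousLinearMap.adjoint_inner_right]
      have h : (𝔾.δ b : HT K K →L[ℂ] HT K K).adjoint
          ((𝔾.δ d : HT K K →L[ℂ] HT K K) (tmul ((c : K →L[ℂ] K) 𝔾.Ω) 𝔾.Ω)) =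
          (𝔾.δ (star b * d) : HT K K →L[ℂ] HT K K) (tmul ((c : K →L[ℂ] K) 𝔾.Ω) 𝔾.Ω) := by
        rw [map_mul, map_star]; rfl
      rw [h, ← inner_sliceR, 𝔾.invariant_right, inner_tmul_tmul]
      have h2 : inner ℂ 𝔾.Ω (((star b * d : 𝔾.alg.toStarSubalgebra) : K →L[ℂ] K) 𝔾.Ω) =
          inner ℂ ((b : K →L[ℂ] K) 𝔾.Ω) ((d : K →L[ℂ] K) 𝔾.Ω) := by
        change inner ℂ 𝔾.Ω ((b : K →L[ℂ] K).adjoint ((d : K →L[ℂ] K) 𝔾.Ω)) = _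
        rw [ContinuousLinearMap.adjoint_inner_right]
      rw [h2]
      change inner ℂ _ ((inner ℂ ((b : K →L[ℂ] K) 𝔾.Ω) ((d : K →L[ℂ] K) 𝔾.Ω) : ℂ) •
        ((c : K →L[ℂ] K) 𝔾.Ω)) = _
      rw [inner_smul_right, mul_comm]

theorem Vstar_gnsMap (x : 𝔾.alg.toStarSubalgebra ⊗[ℂ] 𝔾.alg.toStarSubalgebra) :
    𝔾.Vstar (𝔾.gnsMap x) = 𝔾.coprodMap x := by
  refine LinearMap.extendOfNorm_eq 𝔾.denseRange_gnsMap ⟨1, fun y => ?_⟩ x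
  have h := 𝔾.inner_coprodMap y y
  rw [inner_self_eq_norm_sq_to_K, inner_self_eq_norm_sq_to_K] at h
  have h2 : ‖𝔾.coprodMap y‖ ^ 2 = ‖𝔾.gnsMap y‖ ^ 2 := by exact_mod_cast h
  rw [one_mul]
  exact (sq_le_sq₀ (norm_nonneg _) (norm_nonneg _)).1 h2.le

theorem Vstar_tmul (a b : 𝔾.alg.toStarSubalgebra) :
    𝔾.Vstar (tmul ((a : K →L[ℂ] K) 𝔾.Ω) ((b : K →L[ℂ] K) 𝔾.Ω)) =
      (𝔾.δ b : HT K K →L[ℂ] HT K K) (tmul ((a : K →L[ℂ] K) 𝔾.Ω) 𝔾.Ω) :=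
  𝔾.Vstar_gnsMap (a ⊗ₜ b)

/-- The multiplicative unitary. -/
def V : HT K K →L[ℂ] HT K K := 𝔾.Vstar.adjoint

/-- The von Neumann algebra of the dual discrete Kac algebra, generated by the slices
`(θ ⊗ id)(V)`. -/
def dualAlg : VonNeumannAlgebra K := generatedBy {T | ∃ ξ ξ' : K, T = sliceL ξ ξ' 𝔾.V}

end CompactKacAlgebra

end Kac

section Action

variable {H K : Type*}
  [NormedAddCommGroup H] [InnerProductSpace ℂ H] [CompleteSpace H]
  [NormedAddCommGroup K] [InnerProductSpace ℂ K] [CompleteSpace K]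

/-- An action of the compact Kac algebra `𝔾` on the von Neumann algebra `𝓜`. -/
structure Action (𝔾 : CompactKacAlgebra K) (𝓜 : VonNeumannAlgebra H) where
  toHom : VNHom 𝓜 (vnTensor 𝓜 𝔾.alg)
  injective : Function.Injective toHom
  normal : IsNormal toHom
  /-- `(α ⊗ id) α = (id ⊗ δ) α` -/
  coaction : ∀ x, tensorId toHom 𝔾.alg (toHom x) = reassoc (idTensor 𝓜 𝔾.δ (toHom x))

namespace Action

variable {𝔾 : CompactKacAlgebra K} {𝓜 : VonNeumannAlgebra H} (α : Action 𝔾 𝓜)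

/-- The crossed product, the von Neumann algebra on `H ⊗ L²(𝔾)` generated by `α(𝓜)` and the
operators `1 ⊗ T` with `T` in the commutant of the dual algebra. (For a right action, with
`(α ⊗ id) α = (id ⊗ δ) α`, and a group `𝔾`, this commutant is generated by the right
translations, which implement the action.) -/
def crossedProduct : VonNeumannAlgebra (HT H K) :=
  generatedBy ({X | ∃ x, X = (α.toHom x : HT H K →L[ℂ] HT H K)} ∪
    {X | ∃ T ∈ 𝔾.dualAlg.commutant, X = opTensor 1 T})

/-- `w` is an `α`-cocycle: a unitary of `𝓜 ⊗ A` with `(w ⊗ 1)(α ⊗ id)(w) = (id ⊗ δ)(w)`. -/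
def IsCocycle (w : (vnTensor 𝓜 𝔾.alg).toStarSubalgebra) : Prop :=
  w ∈ unitary (vnTensor 𝓜 𝔾.alg).toStarSubalgebra ∧
    opTensor (w : HT H K →L[ℂ] HT H K) (1 : K →L[ℂ] K) * tensorId α.toHom 𝔾.alg w =
      reassoc (idTensor 𝓜 𝔾.δ w)

/-- `w` is a coboundary: `(u ⊗ 1) w α(u*) = 1` for some unitary `u` of `𝓜`. -/
def IsCoboundary (w : (vnTensor 𝓜 𝔾.alg).toStarSubalgebra) : Prop :=
  ∃ u ∈ unitary 𝓜.toStarSubalgebra,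
    opTensor (u : H →L[ℂ] H) (1 : K →L[ℂ] K) * (w : HT H K →L[ℂ] HT H K) *
      (α.toHom (star u) : HT H K →L[ℂ] HT H K) = 1

end Action

end Action

end

end KacAction

/-! Call `x ∈ 𝓜` an intertwiner when `w α(x) = x ⊗ 1`. A unitary intertwiner `s` proves the theorem
with `u = s*`, because `(s* ⊗ 1) w α(s) = s*s ⊗ 1 = 1`. So the task is to find enough intertwiners.

If `x` and `y` are intertwiners, the factors `w` cancel in `α(x)* α(y)`, so `x*y` is fixed by `α`.
Hence the intertwiners form a ternary ring, closed under `x y* z`, and normality of `α` makes its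
unit ball weakly compact. By Krein–Milman the ball has an extreme point `s`, and Kadison's argument
(`exists_maximal_partialIsometry`) shows that `s` is a partial isometry with `(1 - ss*) x (1 - s*s)
= 0` for every intertwiner `x`.

Factoriality must turn this vanishing into `s*s = 1` or `ss* = 1`; this is
`IsCocycle.eq_zero_or_eq_zero`. Let `p` be the projection onto `ℂΩ`; `1 ⊗ p` lies in the crossed
product. Products `X` of the generators of the crossed product satisfy `(α ⊗ id)(X) V₂₃* = V₂₃*
X₁₃`. Together with the cocycle identity this makes the slice `(id ⊗ ω_Ω)(wX)` an intertwiner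
(`IsCocycle.exists_intertwines_slice`). With `e = 1 - s*s` and `f = 1 - ss*` one gets `(f ⊗ p) w X
(e ⊗ p) = 0` for all such `X`. The ranges of the operators `X (e ⊗ p)` span a closed subspace whose
projection is central, so the subspace is zero or everything: either `e = 0`, or `(f ⊗ p) w = 0` and
then `f = 0`.

Thus `s` is an isometry or a coisometry, and finiteness of `𝓜` makes it unitary. -/

namespace KacAction

noncomputable section

open UniformSpace TensorProduct Filter Topology

set_option linter.unusedSectionVars false

/-! ### Normal homomorphisms and multiplicativity of `φ ⊗ id` -/

section Normality

variable {H K H' : Type*}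
  [NormedAddCommGroup H] [InnerProductSpace ℂ H] [CompleteSpace H]
  [NormedAddCommGroup K] [InnerProductSpace ℂ K] [CompleteSpace K]
  [NormedAddCommGroup H'] [InnerProductSpace ℂ H'] [CompleteSpace H']

/-- A weak limit of elements of a von Neumann algebra belongs to it. -/
theorem mem_of_tendsto_inner {𝓜 : VonNeumannAlgebra H} {ι : Type*} {l : Filter ι} [l.NeBot]
    {X : ι → H →L[ℂ] H} {x : H →L[ℂ] H} (hX : ∀ᶠ i in l, X i ∈ 𝓜)
    (h : ∀ ξ η, Tendsto (fun i => inner ℂ ξ (X i η)) l (𝓝 (inner ℂ ξ (x η)))) : x ∈ 𝓜 := by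
  rw [← VonNeumannAlgebra.commutant_commutant 𝓜, VonNeumannAlgebra.mem_commutant_iff]
  intro S hS
  ext η
  refine ext_inner_left ℂ fun ξ => ?_
  have h1 := h (S.adjoint ξ) η
  simp only [ContinuousLinearMap.adjoint_inner_left] at h1
  refine tendsto_nhds_unique h1 ((h ξ (S η)).congr' ?_)
  filter_upwards [hX] with i hi
  have := DFunLike.congr_fun (VonNeumannAlgebra.mem_commutant_iff.1 hS _ hi) η
  exact congrArg (inner ℂ ξ) this

theorem tendsto_nhds_induced_sigmaWeak {ι S : Type*} {l : Filter ι} (v : S → H →L[ℂ] H)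
    {X : ι → S} {x : S} :
    Tendsto X l (@nhds S (TopologicalSpace.induced v (sigmaWeak H)) x) ↔
      ∀ p : lp (fun _ : ℕ => H) 2 × lp (fun _ : ℕ => H) 2,
        Tendsto (fun i => ∑' n, (inner ℂ (p.1 n) (v (X i) (p.2 n)) : ℂ)) l
          (𝓝 (∑' n, (inner ℂ (p.1 n) (v x (p.2 n)) : ℂ))) := by
  rw [@nhds_induced _ _ (sigmaWeak H), tendsto_comap_iff, sigmaWeak, nhds_iInf, tendsto_iInf]
  refine forall_congr' fun p => ?_
  rw [nhds_induced, tendsto_comap_iff]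
  rfl

/-- A normal homomorphism preserves bounded weak limits. -/
theorem IsNormal.tendsto_inner {𝓜 : VonNeumannAlgebra H} {𝓝' : VonNeumannAlgebra H'}
    {φ : VNHom 𝓜 𝓝'} (hφ : IsNormal φ) {ι : Type*} {l : Filter ι}
    {X : ι → 𝓜.toStarSubalgebra} {x : 𝓜.toStarSubalgebra} (C : ℝ)
    (hC : ∀ᶠ i in l, ‖(X i : H →L[ℂ] H)‖ ≤ C)
    (h : ∀ ξ η, Tendsto (fun i => inner ℂ ξ ((X i : H →L[ℂ] H) η)) l
      (𝓝 (inner ℂ ξ ((x : H →L[ℂ] H) η)))) (ξ η : H') :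
    Tendsto (fun i => inner ℂ ξ ((φ (X i) : H' →L[ℂ] H') η)) l
      (𝓝 (inner ℂ ξ ((φ x : H' →L[ℂ] H') η))) := by
  have h1 : Tendsto X l (@nhds _ (TopologicalSpace.induced Subtype.val (sigmaWeak H)) x) := by
    rw [tendsto_nhds_induced_sigmaWeak]
    intro p
    have hp : ∀ q : lp (fun _ : ℕ => H) 2, Summable fun n => ‖q n‖ ^ 2 := fun q => by
      have := (lp.memℓp q).summable (by norm_num)
      simpa using this
    -- The majorant comes from `‖ξₙ‖‖ηₙ‖ ≤ ‖ξₙ‖² + ‖ηₙ‖²`. The uniform bound `C` is what allows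
    -- termwise convergence to pass through the series.
    have hs : Summable fun n => C * (‖p.1 n‖ ^ 2 + ‖p.2 n‖ ^ 2) :=
      ((hp p.1).add (hp p.2)).mul_left C
    refine tendsto_tsum_of_dominated_convergence hs (fun n => h _ _) ?_
    filter_upwards [hC] with i hi n
    have hC0 : 0 ≤ C := (norm_nonneg _).trans hi
    calc ‖inner ℂ (p.1 n) ((X i : H →L[ℂ] H) (p.2 n))‖
        ≤ ‖p.1 n‖ * (C * ‖p.2 n‖) := (norm_inner_le_norm _ _).trans
          (mul_le_mul_of_nonneg_left (ContinuousLinearMap.le_of_opNorm_le _ hi _) (norm_nonneg _))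
      _ = C * (‖p.1 n‖ * ‖p.2 n‖) := by ring
      _ ≤ _ := mul_le_mul_of_nonneg_left
          (by nlinarith [sq_nonneg (‖p.1 n‖ - ‖p.2 n‖), sq_nonneg (‖p.1 n‖), sq_nonneg (‖p.2 n‖)]) hC0
  have h2 := (@Continuous.tendsto _ _ (_) (_) _ hφ x).comp h1
  rw [tendsto_nhds_induced_sigmaWeak] at h2
  -- Sequences supported at index `0` reduce a σ-weak functional to a single vector functional.
  have h3 := h2 (lp.single 2 0 ξ, lp.single 2 0 η)
  have h4 : ∀ T : H' →L[ℂ] H', ∑' n, (inner ℂ ((lp.single 2 0 ξ : lp (fun _ : ℕ => H') 2) n)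
      (T ((lp.single 2 0 η : lp (fun _ : ℕ => H') 2) n)) : ℂ) = inner ℂ ξ (T η) := fun T => by
    rw [tsum_eq_single 0]
    · simp
    · intro n hn
      simp [lp.single_apply, hn]
  simpa only [Function.comp_def, h4] using h3

/-- Strong convergence of contractions to the identity need only be checked on a total set; for a
subspace of `H ⊗ K` this means on elementary tensors. -/
theorem isClosed_setOf_tendsto_apply {E ι : Type*} [NormedAddCommGroup E] [NormedSpace ℂ E]
    {l : Filter ι} {T : ι → E →L[ℂ] E} (hT : ∀ i, ‖T i‖ ≤ 1) :
    IsClosed {v | Tendsto (fun i => T i v) l (𝓝 v)} := by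
  refine isClosed_of_closure_subset fun v hv => ?_
  rw [Set.mem_ofPred_eq, Metric.tendsto_nhds]
  intro ε hε
  obtain ⟨v', hv', hd⟩ := Metric.mem_closure_iff.1 hv (ε / 3) (by positivity)
  filter_upwards [Metric.tendsto_nhds.1 hv' (ε / 3) (by positivity)] with i hi
  have h1 : dist (T i v) (T i v') ≤ dist v v' := by
    rw [dist_eq_norm, dist_eq_norm, ← map_sub]
    simpa using (T i).le_of_opNorm_le (hT i) (v - v')
  have h2 := dist_triangle4 (T i v) (T i v') v' v
  rw [dist_comm v' v] at h2
  linarith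

theorem norm_sum_rankOne_le {ι : Type*} {b : ι → K} (hb : Orthonormal ℂ b) (F : Finset ι) :
    ‖∑ i ∈ F, InnerProductSpace.rankOne ℂ (b i) (b i)‖ ≤ 1 := by
  refine ContinuousLinearMap.opNorm_le_bound _ zero_le_one fun η => ?_
  rw [one_mul]
  refine (sq_le_sq₀ (norm_nonneg _) (norm_nonneg _)).1 ?_
  refine le_trans (le_of_eq ?_) (hb.sum_inner_products_le (s := F) η)
  rw [← RCLike.ofReal_inj (K := ℂ), RCLike.ofReal_pow, ← inner_self_eq_norm_sq_to_K]
  simp only [sum_apply, InnerProductSpace.rankOne_apply]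
  rw [hb.inner_sum]
  push_cast
  exact Finset.sum_congr rfl fun i _ => RCLike.conj_mul _

theorem norm_opTensor_one_le {P : K →L[ℂ] K} (hP : ‖P‖ ≤ 1) :
    ‖opTensor (1 : H →L[ℂ] H) P‖ ≤ 1 :=
  (norm_opTensor_le _ _).trans (mul_le_one₀ ContinuousLinearMap.norm_id_le (norm_nonneg _) hP)

theorem tendsto_opTensor_sum_rankOne {ι : Type*} (b : HilbertBasis ι ℂ K) (u : HT H K) :
    Tendsto (fun F : Finset ι => opTensor (1 : H →L[ℂ] H)
      (∑ i ∈ F, InnerProductSpace.rankOne ℂ (b i) (b i)) u) atTop (𝓝 u) := by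
  let S : Submodule ℂ (HT H K) :=
    { carrier := {v | Tendsto (fun F : Finset ι => opTensor (1 : H →L[ℂ] H)
        (∑ i ∈ F, InnerProductSpace.rankOne ℂ (b i) (b i)) v) atTop (𝓝 v)}
      add_mem' := fun {v w} hv hw => by simpa using Tendsto.add hv hw
      zero_mem' := by simp
      smul_mem' := fun c v hv => by simpa using Tendsto.const_smul hv c }
  have hS : S = ⊤ := submodule_eq_top S
    (isClosed_setOf_tendsto_apply fun F => norm_opTensor_one_le
      (norm_sum_rankOne_le b.orthonormal F)) fun ξ η => by
    change Tendsto _ _ _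
    simp only [opTensor_tmul]
    refine ((leftLeg (K := K) ξ).continuous.tendsto η).comp ?_
    simpa [HasSum, sum_apply, HilbertBasis.repr_apply_apply] using b.hasSum_repr η
  exact (hS ▸ Submodule.mem_top : u ∈ S)

/-- The operator `1 ⊗ |e⟩⟨e'|` factors through `H` as `rightLeg e ∘ (rightLeg e')*`, which cuts the
slice of the product into two slices. -/
theorem sliceR_mul_opTensor_rankOne_mul (X X' : HT H K →L[ℂ] HT H K) (e e' η η' : K) :
    sliceR η η' (X * opTensor 1 (InnerProductSpace.rankOne ℂ e e') * X') =
      sliceR η e X * sliceR e' η' X' := by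
  ext x
  refine ext_inner_left ℂ fun y => ?_
  have h : opTensor (1 : H →L[ℂ] H) (InnerProductSpace.rankOne ℂ e e') =
      rightLeg e ∘L (rightLeg e').adjoint := clm_ext_inner fun ξ μ ξ' μ' => by
    have : (rightLeg e').adjoint (tmul ξ' μ') = (inner ℂ e' μ' : ℂ) • ξ' := by
      refine ext_inner_left ℂ fun z => ?_
      simp [ContinuousLinearMap.adjoint_inner_right, inner_smul_right, mul_comm]
    simp [this, inner_smul_right, tmul_smul, mul_left_comm]
  rw [h]
  rfl

theorem sliceR_sum {ι : Type*} (F : Finset ι) (X : ι → HT H K →L[ℂ] HT H K) (η η' : K) :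
    sliceR η η' (∑ i ∈ F, X i) = ∑ i ∈ F, sliceR η η' (X i) := by
  ext x
  refine ext_inner_left ℂ fun y => ?_
  simp [inner_sliceR, sum_apply, inner_sum]

theorem opTensor_sum_right {ι : Type*} (F : Finset ι) (S : H →L[ℂ] H) (T : ι → K →L[ℂ] K) :
    opTensor S (∑ i ∈ F, T i) = ∑ i ∈ F, opTensor S (T i) :=
  clm_ext fun ξ η => by simp [sum_apply, tmul_sum_right]

theorem sum_sliceR_mul_sliceR {ι : Type*} (b : ι → K) (F : Finset ι)
    (X X' : HT H K →L[ℂ] HT H K) (η η' : K) :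
    ∑ i ∈ F, sliceR η (b i) X * sliceR (b i) η' X' = sliceR η η'
      (X * opTensor 1 (∑ i ∈ F, InnerProductSpace.rankOne ℂ (b i) (b i)) * X') := by
  rw [opTensor_sum_right, Finset.mul_sum, Finset.sum_mul, sliceR_sum]
  simp only [sliceR_mul_opTensor_rankOne_mul]

/-- Matrix multiplication for slices: the finite-rank projections of an orthonormal basis, amplified
to `H ⊗ K`, tend strongly to `1` and may be inserted between the two factors. -/
theorem tendsto_sum_sliceR_mul_sliceR {ι : Type*} (b : HilbertBasis ι ℂ K)
    (X X' : HT H K →L[ℂ] HT H K) (η η' : K) (ξ ξ' : H) :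
    Tendsto (fun F : Finset ι => inner ℂ ξ ((∑ i ∈ F, sliceR η (b i) X * sliceR (b i) η' X') ξ'))
      atTop (𝓝 (inner ℂ ξ (sliceR η η' (X * X') ξ'))) := by
  simp only [sum_sliceR_mul_sliceR, inner_sliceR]
  exact tendsto_const_nhds.inner
    ((X.continuous.tendsto _).comp (tendsto_opTensor_sum_rankOne b (X' (tmul ξ' η'))))

theorem norm_sum_sliceR_mul_sliceR_le {ι : Type*} {b : ι → K} (hb : Orthonormal ℂ b)
    (F : Finset ι) (X X' : HT H K →L[ℂ] HT H K) (η η' : K) :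
    ‖∑ i ∈ F, sliceR η (b i) X * sliceR (b i) η' X'‖ ≤
      ‖(rightLeg (H := H) η).adjoint‖ * (‖X‖ * ‖X'‖ * ‖rightLeg (H := H) η'‖) := by
  rw [sum_sliceR_mul_sliceR]
  refine (ContinuousLinearMap.opNorm_comp_le _ _).trans
    (mul_le_mul_of_nonneg_left ?_ (norm_nonneg _))
  refine (ContinuousLinearMap.opNorm_comp_le _ _).trans
    (mul_le_mul_of_nonneg_right ?_ (norm_nonneg _))
  refine (norm_mul_le _ _).trans (mul_le_mul_of_nonneg_right ?_ (norm_nonneg _))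
  refine (norm_mul_le _ _).trans (mul_le_of_le_one_right (norm_nonneg _) ?_)
  exact norm_opTensor_one_le (norm_sum_rankOne_le hb F)

/-- `Y = (φ ⊗ id)(X)`, expressed through the slices of the two operators. -/
def IsAmplification {𝓜 : VonNeumannAlgebra H} {𝓝' : VonNeumannAlgebra H'} (φ : VNHom 𝓜 𝓝')
    (X : HT H K →L[ℂ] HT H K) (Y : HT H' K →L[ℂ] HT H' K) : Prop :=
  ∀ η η', ∃ h : sliceR η η' X ∈ 𝓜, sliceR η η' Y = (φ (elem 𝓜 _ h) : H' →L[ℂ] H')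

theorem isAmplification_tensorId {𝓜 : VonNeumannAlgebra H} {𝓝' : VonNeumannAlgebra H'}
    (φ : VNHom 𝓜 𝓝') (𝓐 : VonNeumannAlgebra K) (X : (vnTensor 𝓜 𝓐).toStarSubalgebra) :
    IsAmplification φ (X : HT H K →L[ℂ] HT H K) (tensorId φ 𝓐 X) := fun η η' =>
  ⟨sliceR_mem' X η η', sliceR_tensorId φ 𝓐 X η η'⟩

/-- The slices of `1 ⊗ T` are scalars, and a unital homomorphism fixes scalars. -/
theorem isAmplification_one_opTensor {𝓜 : VonNeumannAlgebra H} {𝓝' : VonNeumannAlgebra H'}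
    (φ : VNHom 𝓜 𝓝') (T : K →L[ℂ] K) : IsAmplification φ (opTensor 1 T) (opTensor 1 T) := by
  intro η η'
  have h : ∀ c : ℂ, c • (1 : H →L[ℂ] H) ∈ 𝓜 := fun c =>
    coe_mem_vn 𝓜 (c • (1 : 𝓜.toStarSubalgebra))
  have hs := sliceR_opTensor (1 : H →L[ℂ] H) T η η'
  refine ⟨by rw [hs]; exact h _, ?_⟩
  have h2 : elem 𝓜 (sliceR η η' (opTensor (1 : H →L[ℂ] H) T)) (by rw [hs]; exact h _) =
      (inner ℂ η (T η') : ℂ) • 1 := Subtype.ext hs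
  rw [h2, map_smul, map_one, sliceR_opTensor]
  rfl

/-- A slice of `XX'` is a weak limit of finite sums of products of slices. `φ` respects each finite
sum, the sums are uniformly bounded, and normality carries `φ` to the limit. -/
theorem IsAmplification.mul {𝓜 : VonNeumannAlgebra H} {𝓝' : VonNeumannAlgebra H'}
    {φ : VNHom 𝓜 𝓝'} (hφ : IsNormal φ) {X X' : HT H K →L[ℂ] HT H K}
    {Y Y' : HT H' K →L[ℂ] HT H' K} (h : IsAmplification φ X Y) (h' : IsAmplification φ X' Y') :
    IsAmplification φ (X * X') (Y * Y') := by
  intro η η'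
  obtain ⟨s, b, -⟩ := exists_hilbertBasis ℂ K
  let x : Finset s → 𝓜.toStarSubalgebra := fun F => ∑ i ∈ F,
    elem 𝓜 _ (h η (b i)).choose * elem 𝓜 _ (h' (b i) η').choose
  have hx : ∀ F, (x F : H →L[ℂ] H) = ∑ i ∈ F, sliceR η (b i) X * sliceR (b i) η' X' := fun F => by
    simp only [x, AddSubmonoidClass.coe_finsetSum]
    rfl
  have hφx : ∀ F, (φ (x F) : H' →L[ℂ] H') =
      ∑ i ∈ F, sliceR η (b i) Y * sliceR (b i) η' Y' := fun F => by
    simp only [x, map_sum, map_mul, AddSubmonoidClass.coe_finsetSum]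
    refine Finset.sum_congr rfl fun i _ => ?_
    exact congrArg₂ (· * ·) (h η (b i)).choose_spec.symm (h' (b i) η').choose_spec.symm
  have hlim := tendsto_sum_sliceR_mul_sliceR b X X' η η'
  simp only [← hx] at hlim
  have hmem : sliceR η η' (X * X') ∈ 𝓜 :=
    mem_of_tendsto_inner (Eventually.of_forall fun F => coe_mem_vn 𝓜 (x F)) hlim
  refine ⟨hmem, ?_⟩
  ext ξ'
  refine ext_inner_left ℂ fun ξ => ?_
  refine tendsto_nhds_unique (tendsto_sum_sliceR_mul_sliceR b Y Y' η η' ξ ξ') ?_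
  refine Tendsto.congr (fun F => by rw [← hφx]) ?_
  have hbound : ∀ F, ‖(x F : H →L[ℂ] H)‖ ≤
      ‖(rightLeg (H := H) η).adjoint‖ * (‖X‖ * ‖X'‖ * ‖rightLeg (H := H) η'‖) := fun F => by
    rw [hx]
    exact norm_sum_sliceR_mul_sliceR_le b.orthonormal F X X' η η'
  exact hφ.tendsto_inner (x := elem 𝓜 _ hmem) _ (Eventually.of_forall hbound) hlim ξ ξ'

end Normality

/-! ### Leg calculus on tensor products -/

section Legs

variable {H K L : Type*}
  [NormedAddCommGroup H] [InnerProductSpace ℂ H] [CompleteSpace H]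
  [NormedAddCommGroup K] [InnerProductSpace ℂ K] [CompleteSpace K]
  [NormedAddCommGroup L] [InnerProductSpace ℂ L] [CompleteSpace L]

@[simp] theorem adjoint_rightLeg_tmul (η η' : K) (ξ : H) :
    (rightLeg η).adjoint (tmul ξ η') = (inner ℂ η η' : ℂ) • ξ := by
  refine ext_inner_left ℂ fun z => ?_
  simp [ContinuousLinearMap.adjoint_inner_right, inner_smul_right, mul_comm]

@[simp] theorem adjoint_leftLeg_tmul (ξ ξ' : H) (η : K) :
    (leftLeg ξ).adjoint (tmul ξ' η) = (inner ℂ ξ ξ' : ℂ) • η := by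
  refine ext_inner_left ℂ fun z => ?_
  simp [ContinuousLinearMap.adjoint_inner_right, inner_smul_right]

theorem adjoint_rightLeg_opTensor_one (S : H →L[ℂ] H) (η : K) :
    (rightLeg η).adjoint ∘L opTensor S 1 = S ∘L (rightLeg η).adjoint :=
  clm_ext fun ξ η' => by simp

theorem adjoint_leftLeg_one_opTensor (T : K →L[ℂ] L) (ξ : H) :
    (leftLeg ξ).adjoint ∘L opTensor 1 T = T ∘L (leftLeg ξ).adjoint :=
  clm_ext fun ξ η' => by simp

theorem clm_ext_assoc {E : Type*} [NormedAddCommGroup E] [NormedSpace ℂ E]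
    {S T : HT (HT H K) L →L[ℂ] E}
    (h : ∀ ξ η ζ, S (tmul (tmul ξ η) ζ) = T (tmul (tmul ξ η) ζ)) : S = T :=
  clm_ext fun x ζ => by
    have : S ∘L rightLeg ζ = T ∘L rightLeg ζ := clm_ext fun ξ η => h ξ η ζ
    exact DFunLike.congr_fun this x

theorem adjoint_assocMap_tmul (ξ : H) (η : K) (ζ : L) :
    (assocMap H K L).adjoint (tmul ξ (tmul η ζ)) = tmul (tmul ξ η) ζ := by
  refine ext_inner_right ℂ fun y => ?_
  rw [ContinuousLinearMap.adjoint_inner_left]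
  have : innerSL ℂ (tmul ξ (tmul η ζ)) ∘L assocMap H K L = innerSL ℂ (tmul (tmul ξ η) ζ) :=
    clm_ext_assoc fun a b c => by simp [mul_assoc]
  exact DFunLike.congr_fun this y

theorem assocMap_adjoint_apply (x : HT H (HT K L)) :
    assocMap H K L ((assocMap H K L).adjoint x) = x := by
  have : assocMap H K L ∘L (assocMap H K L).adjoint = .id ℂ _ := clm_ext fun ξ y => by
    have h : (assocMap H K L ∘L (assocMap H K L).adjoint) ∘L leftLeg ξ = leftLeg ξ :=
      clm_ext fun η ζ => by simp [adjoint_assocMap_tmul]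
    exact DFunLike.congr_fun h y
  exact DFunLike.congr_fun this x

theorem tmul_eq_zero {ξ : H} {η : K} (h : tmul ξ η = 0) (hη : η ≠ 0) : ξ = 0 := by
  have h2 := inner_tmul_tmul ξ ξ η η
  rw [h, inner_zero_left, eq_comm, mul_eq_zero, inner_self_eq_zero, inner_self_eq_zero] at h2
  exact h2.resolve_right hη

theorem commutant_generatedBy (S : Set (H →L[ℂ] H)) :
    (generatedBy S).commutant = commutantOf S :=
  VonNeumannAlgebra.commutant_commutant _

/-- The projection onto a closed subspace commutes with the operators that it reduces. -/
theorem commute_starProjection {U : Submodule ℂ H} [U.HasOrthogonalProjection] {g : H →L[ℂ] H}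
    (h : ∀ v ∈ U, g v ∈ U) (h' : ∀ v ∈ U, g.adjoint v ∈ U) :
    g * U.starProjection = U.starProjection * g := by
  ext v
  refine (Submodule.eq_starProjection_of_mem_of_inner_eq_zero
    (h _ (Submodule.starProjection_apply_mem U v)) fun u hu => ?_).symm
  change inner ℂ (g v - g (U.starProjection v)) u = 0
  rw [← map_sub, ← ContinuousLinearMap.adjoint_inner_right]
  exact Submodule.starProjection_inner_eq_zero _ _ (h' u hu)

end Legs

/-! ### The multiplicative unitary, the vacuum projection and the coproduct -/

namespace CompactKacAlgebra

variable {H K : Type*}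
  [NormedAddCommGroup H] [InnerProductSpace ℂ H] [CompleteSpace H]
  [NormedAddCommGroup K] [InnerProductSpace ℂ K] [CompleteSpace K]
  (𝔾 : CompactKacAlgebra K)

theorem inner_Ω_Ω : inner ℂ 𝔾.Ω 𝔾.Ω = (1 : ℂ) := by
  rw [inner_self_eq_norm_sq_to_K, 𝔾.norm_Ω]; simp

theorem Ω_ne_zero : 𝔾.Ω ≠ 0 := fun h => by simpa [h] using 𝔾.norm_Ω

/-- This is `δ(1) = 1`, extended from the dense set of vectors `aΩ`. -/
theorem Vstar_tmul_Ω (k : K) : 𝔾.Vstar (tmul k 𝔾.Ω) = tmul k 𝔾.Ω := by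
  have h : Set.EqOn (𝔾.Vstar ∘L rightLeg 𝔾.Ω) (rightLeg 𝔾.Ω)
      {η : K | ∃ a ∈ 𝔾.alg, η = a 𝔾.Ω} := by
    rintro _ ⟨a, ha, rfl⟩
    have h1 := 𝔾.Vstar_tmul ⟨a, ha⟩ 1
    rw [map_one] at h1
    exact h1
  exact congrFun (Continuous.ext_on 𝔾.cyclic (ContinuousLinearMap.continuous _)
    (ContinuousLinearMap.continuous _) h) k

theorem inner_Vstar_Vstar (x y : HT K K) :
    inner ℂ (𝔾.Vstar x) (𝔾.Vstar y) = inner ℂ x y := by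
  refine 𝔾.denseRange_gnsMap.induction_on₂ ?_ (fun a b => ?_) x y
  · exact isClosed_eq (by fun_prop) (by fun_prop)
  · rw [Vstar_gnsMap, Vstar_gnsMap, inner_coprodMap]

/-- `V` is a left inverse of the isometry `V*`, so it fixes every vector that `V*` fixes. -/
theorem V_tmul_Ω (k : K) : 𝔾.V (tmul k 𝔾.Ω) = tmul k 𝔾.Ω := by
  refine ext_inner_left ℂ fun y => ?_
  rw [V, ContinuousLinearMap.adjoint_inner_right, ← 𝔾.inner_Vstar_Vstar y, Vstar_tmul_Ω]

/-- The identity `V*(1 ⊗ a) = δ(a)V*`; on vectors `bΩ ⊗ cΩ` it is the multiplicativity `δ(ac) =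
δ(a)δ(c)`. -/
theorem Vstar_tmul_apply (a : 𝔾.alg.toStarSubalgebra) (k ζ : K) :
    𝔾.Vstar (tmul k ((a : K →L[ℂ] K) ζ)) = (𝔾.δ a : HT K K →L[ℂ] HT K K) (𝔾.Vstar (tmul k ζ)) := by
  have h : ⇑(𝔾.Vstar ∘L opTensor 1 (a : K →L[ℂ] K)) =
      ⇑((𝔾.δ a : HT K K →L[ℂ] HT K K) ∘L 𝔾.Vstar) := by
    refine 𝔾.denseRange_gnsMap.equalizer (ContinuousLinearMap.continuous _)
      (ContinuousLinearMap.continuous _) (funext fun x => ?_)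
    induction x using TensorProduct.induction_on with
    | zero => simp
    | add x y hx hy =>
      simp only [Function.comp_apply, map_add] at hx hy ⊢
      rw [hx, hy]
    | tmul b c =>
      have hg : 𝔾.gnsMap (b ⊗ₜ c) = tmul ((b : K →L[ℂ] K) 𝔾.Ω) ((c : K →L[ℂ] K) 𝔾.Ω) := rfl
      rw [Function.comp_apply, Function.comp_apply, hg, ContinuousLinearMap.comp_apply,
        opTensor_tmul]
      change 𝔾.Vstar (tmul ((b : K →L[ℂ] K) 𝔾.Ω) (((a * c : 𝔾.alg.toStarSubalgebra) : K →L[ℂ] K)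
        𝔾.Ω)) = (𝔾.δ a : HT K K →L[ℂ] HT K K)
          (𝔾.Vstar (tmul ((b : K →L[ℂ] K) 𝔾.Ω) ((c : K →L[ℂ] K) 𝔾.Ω)))
      rw [Vstar_tmul, Vstar_tmul, map_mul]
      rfl
  simpa using congrFun h (tmul k ζ)

theorem star_sliceL_V (ξ ξ' : K) : star (sliceL ξ ξ' 𝔾.V) = sliceL ξ' ξ 𝔾.Vstar := by
  ext η
  refine ext_inner_left ℂ fun η' => ?_
  rw [ContinuousLinearMap.star_eq_adjoint, ContinuousLinearMap.adjoint_inner_right,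
    inner_sliceL, ← inner_conj_symm, inner_sliceL, V, ContinuousLinearMap.adjoint_inner_right,
    inner_conj_symm]

/-- The second leg of `V*` lies in the dual algebra: its left slices are adjoints of the generating
slices of `V`, so `T` commutes with each of them. -/
theorem Vstar_tmul_commutant {T : K →L[ℂ] K} (hT : T ∈ 𝔾.dualAlg.commutant) (k ζ : K) :
    𝔾.Vstar (tmul k (T ζ)) = opTensor 1 T (𝔾.Vstar (tmul k ζ)) := by
  refine ext_inner fun m n => ?_
  rw [dualAlg, commutant_generatedBy, mem_commutantOf] at hT
  have h := (hT _ ⟨k, m, rfl⟩).2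
  rw [star_sliceL_V] at h
  have h2 := congrArg (fun Z : K →L[ℂ] K => inner ℂ n (Z ζ)) h
  have h3 := DFunLike.congr_fun (adjoint_leftLeg_one_opTensor T m) (𝔾.Vstar (tmul k ζ))
  simp only [mul_apply_eq_comp] at h2
  rw [inner_sliceL] at h2
  rw [h2]
  change inner ℂ n (T ((leftLeg m).adjoint (𝔾.Vstar (tmul k ζ)))) = _
  change (leftLeg m).adjoint _ = T ((leftLeg m).adjoint (𝔾.Vstar (tmul k ζ))) at h3
  rw [← h3, ContinuousLinearMap.adjoint_inner_right]
  rfl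

/-- The projection onto the line spanned by the cyclic vector. -/
def vacuum : K →L[ℂ] K := InnerProductSpace.rankOne ℂ 𝔾.Ω 𝔾.Ω

theorem vacuum_apply (η : K) : 𝔾.vacuum η = (inner ℂ 𝔾.Ω η : ℂ) • 𝔾.Ω := by
  simp [vacuum]

/-- Since `V` and `V*` fix every `k ⊗ Ω`, the vector `Ω` is a common eigenvector of the slices of
`V` and of their adjoints, with conjugate eigenvalues. -/
theorem vacuum_mem : 𝔾.vacuum ∈ 𝔾.dualAlg.commutant := by
  rw [dualAlg, commutant_generatedBy, mem_commutantOf]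
  have key : ∀ (s : K →L[ℂ] K) (c : ℂ), s 𝔾.Ω = c • 𝔾.Ω → s.adjoint 𝔾.Ω = starRingEnd ℂ c • 𝔾.Ω →
      s * 𝔾.vacuum = 𝔾.vacuum * s := fun s c h h' => by
    ext η
    rw [mul_apply_eq_comp, mul_apply_eq_comp, vacuum_apply, vacuum_apply,
      map_smul, h, ← ContinuousLinearMap.adjoint_inner_left, h', inner_smul_left,
      Complex.conj_conj, smul_smul, mul_comm]
  rintro _ ⟨ξ, ξ', rfl⟩
  have h1 : sliceL ξ ξ' 𝔾.V 𝔾.Ω = (inner ℂ ξ ξ' : ℂ) • 𝔾.Ω := by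
    change (leftLeg ξ).adjoint (𝔾.V (tmul ξ' 𝔾.Ω)) = _
    rw [V_tmul_Ω, adjoint_leftLeg_tmul]
  have h2 : (sliceL ξ ξ' 𝔾.V).adjoint 𝔾.Ω = starRingEnd ℂ (inner ℂ ξ ξ' : ℂ) • 𝔾.Ω := by
    rw [← ContinuousLinearMap.star_eq_adjoint, star_sliceL_V]
    change (leftLeg ξ').adjoint (𝔾.Vstar (tmul ξ 𝔾.Ω)) = _
    rw [Vstar_tmul_Ω, adjoint_leftLeg_tmul, inner_conj_symm]
  refine ⟨key _ _ h1 h2, key _ (starRingEnd ℂ (inner ℂ ξ ξ')) ?_ ?_⟩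
  · rw [ContinuousLinearMap.star_eq_adjoint, h2]
  · rw [ContinuousLinearMap.star_eq_adjoint, ContinuousLinearMap.adjoint_adjoint, h1,
      Complex.conj_conj]

/-- The operator `ξ ⊗ ζ ↦ ξ ⊗ V*(k ⊗ ζ)`. -/
def coactionLeg (H : Type*) [NormedAddCommGroup H] [InnerProductSpace ℂ H] [CompleteSpace H]
    (k : K) : HT H K →L[ℂ] HT (HT H K) K :=
  (assocMap H K K).adjoint ∘L opTensor 1 (𝔾.Vstar ∘L leftLeg k)

theorem coactionLeg_tmul (k : K) (ξ : H) (ζ : K) : 𝔾.coactionLeg H k (tmul ξ ζ) =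
    (assocMap H K K).adjoint (tmul ξ (𝔾.Vstar (tmul k ζ))) := by
  simp [coactionLeg]

theorem inner_coactionLeg (k : K) (ξ : H) (m n : K) (x : HT H K) :
    inner ℂ (tmul (tmul ξ m) n) (𝔾.coactionLeg H k x) =
      inner ℂ (tmul m n) (𝔾.Vstar (tmul k ((leftLeg ξ).adjoint x))) := by
  have h := DFunLike.congr_fun (adjoint_leftLeg_one_opTensor (𝔾.Vstar ∘L leftLeg k) ξ) x
  change (leftLeg ξ).adjoint _ = 𝔾.Vstar (tmul k ((leftLeg ξ).adjoint x)) at h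
  rw [← h, ContinuousLinearMap.adjoint_inner_right, coactionLeg, ContinuousLinearMap.comp_apply,
    ContinuousLinearMap.adjoint_inner_right, assocMap_tmul]
  rfl

theorem clm_ext_inner_assoc {H L : Type*} [NormedAddCommGroup H] [InnerProductSpace ℂ H]
    [CompleteSpace H] [NormedAddCommGroup L] [InnerProductSpace ℂ L] [CompleteSpace L]
    {S T : HT H K →L[ℂ] HT (HT H K) L}
    (h : ∀ ξ m n ξ' ζ, inner ℂ (tmul (tmul ξ m) n) (S (tmul ξ' ζ)) =
      inner ℂ (tmul (tmul ξ m) n) (T (tmul ξ' ζ))) : S = T :=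
  clm_ext fun ξ' ζ => by
    have : innerSL ℂ (S (tmul ξ' ζ)) = innerSL ℂ (T (tmul ξ' ζ)) := clm_ext_assoc fun a b c => by
      rw [innerSL_apply_apply, innerSL_apply_apply, ← inner_conj_symm, h, inner_conj_symm]
    refine ext_inner_right ℂ fun y => DFunLike.congr_fun this y

/-- The identity `(id ⊗ δ)(Z) V₂₃* = V₂₃* Z₁₃`, obtained by applying `V*(1 ⊗ a) = δ(a)V*` to the
left slices of `Z`. -/
theorem reassoc_idTensor_coactionLeg {𝓜 : VonNeumannAlgebra H}
    (Z : (vnTensor 𝓜 𝔾.alg).toStarSubalgebra) (k : K) :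
    reassoc (idTensor 𝓜 𝔾.δ Z) ∘L 𝔾.coactionLeg H k =
      𝔾.coactionLeg H k ∘L (Z : HT H K →L[ℂ] HT H K) :=
  clm_ext_inner_assoc fun ξ m n ξ' ζ => by
    rw [ContinuousLinearMap.comp_apply, ContinuousLinearMap.comp_apply, inner_coactionLeg,
      coactionLeg_tmul, reassoc, ContinuousLinearMap.comp_apply, ContinuousLinearMap.comp_apply,
      assocMap_adjoint_apply, ContinuousLinearMap.adjoint_inner_right, assocMap_tmul,
      ← inner_sliceL, sliceL_idTensor, ← Vstar_tmul_apply]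
    rfl

theorem one_opTensor_coactionLeg {T : K →L[ℂ] K} (hT : T ∈ 𝔾.dualAlg.commutant) (k : K) :
    opTensor 1 T ∘L 𝔾.coactionLeg H k = 𝔾.coactionLeg H k ∘L opTensor 1 T :=
  clm_ext fun ξ ζ => by
    have h : opTensor 1 T ∘L (assocMap H K K).adjoint =
        (assocMap H K K).adjoint ∘L opTensor 1 (opTensor 1 T) := clm_ext fun a y => by
      have : (opTensor 1 T ∘L (assocMap H K K).adjoint) ∘L leftLeg a =
        ((assocMap H K K).adjoint ∘L opTensor 1 (opTensor 1 T)) ∘L leftLeg a :=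
          clm_ext fun b c => by simp [adjoint_assocMap_tmul]
      exact DFunLike.congr_fun this y
    have h2 := DFunLike.congr_fun h (tmul ξ (𝔾.Vstar (tmul k ζ)))
    rw [ContinuousLinearMap.comp_apply, ContinuousLinearMap.comp_apply, opTensor_tmul,
      coactionLeg_tmul, coactionLeg_tmul, 𝔾.Vstar_tmul_commutant hT]
    rw [ContinuousLinearMap.comp_apply, ContinuousLinearMap.comp_apply, opTensor_tmul] at h2
    exact h2

theorem coactionLeg_tmul_Ω (k : K) (ξ : H) :
    𝔾.coactionLeg H k (tmul ξ 𝔾.Ω) = tmul (tmul ξ k) 𝔾.Ω := by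
  rw [coactionLeg_tmul, Vstar_tmul_Ω, adjoint_assocMap_tmul]

/-- As `V*` is isometric and fixes `m ⊗ Ω`, pairing `V*(k ⊗ ζ)` with `m ⊗ Ω` gives `⟪m, k⟫⟪Ω, ζ⟫`.
-/
theorem adjoint_rightLeg_coactionLeg (k : K) :
    (rightLeg 𝔾.Ω).adjoint ∘L 𝔾.coactionLeg H k = rightLeg k ∘L (rightLeg 𝔾.Ω).adjoint :=
  clm_ext_inner fun ξ m ξ' ζ => by
    rw [ContinuousLinearMap.comp_apply, ContinuousLinearMap.adjoint_inner_right, rightLeg_apply,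
      inner_coactionLeg, adjoint_leftLeg_tmul, tmul_smul, map_smul, inner_smul_right,
      ← 𝔾.Vstar_tmul_Ω m, inner_Vstar_Vstar, inner_tmul_tmul, ContinuousLinearMap.comp_apply,
      adjoint_rightLeg_tmul, rightLeg_apply, smul_tmul, inner_smul_right, inner_tmul_tmul]
    ring

end CompactKacAlgebra

/-! ### Intertwiners from equivariant operators, and factoriality -/

namespace Action

variable {H K : Type*}
  [NormedAddCommGroup H] [InnerProductSpace ℂ H] [CompleteSpace H]
  [NormedAddCommGroup K] [InnerProductSpace ℂ K] [CompleteSpace K]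
  {𝔾 : CompactKacAlgebra K} {𝓜 : VonNeumannAlgebra H} (α : Action 𝔾 𝓜)

/-- The operators `X` with `(α ⊗ id)(X) V₂₃* = V₂₃* X₁₃`. -/
def IsEquivariant (X : HT H K →L[ℂ] HT H K) : Prop :=
  ∃ Y : HT (HT H K) K →L[ℂ] HT (HT H K) K, IsAmplification α.toHom X Y ∧
    ∀ k, Y ∘L 𝔾.coactionLeg H k = 𝔾.coactionLeg H k ∘L X

theorem IsEquivariant.mul {X X' : HT H K →L[ℂ] HT H K} (h : α.IsEquivariant X)
    (h' : α.IsEquivariant X') : α.IsEquivariant (X * X') := by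
  obtain ⟨Y, hY, hk⟩ := h
  obtain ⟨Y', hY', hk'⟩ := h'
  refine ⟨Y * Y', hY.mul α.normal hY', fun k => ?_⟩
  change Y ∘L (Y' ∘L 𝔾.coactionLeg H k) = _
  rw [hk', ← ContinuousLinearMap.comp_assoc, hk]
  rfl

/-- The coaction identity replaces `(α ⊗ id)α(x)` by `(id ⊗ δ)α(x)`, which `V₂₃*` implements. -/
theorem isEquivariant_toHom (x : 𝓜.toStarSubalgebra) :
    α.IsEquivariant (α.toHom x : HT H K →L[ℂ] HT H K) := by
  refine ⟨_, isAmplification_tensorId α.toHom 𝔾.alg (α.toHom x), fun k => ?_⟩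
  rw [α.coaction, 𝔾.reassoc_idTensor_coactionLeg]

theorem isEquivariant_one_opTensor {T : K →L[ℂ] K} (hT : T ∈ 𝔾.dualAlg.commutant) :
    α.IsEquivariant (opTensor 1 T) :=
  ⟨_, isAmplification_one_opTensor α.toHom T, fun k => 𝔾.one_opTensor_coactionLeg hT k⟩

/-- `x` intertwines `α` with its perturbation by `w`, that is, `w α(x) = x ⊗ 1`. -/
def Intertwines (w : (vnTensor 𝓜 𝔾.alg).toStarSubalgebra) (x : 𝓜.toStarSubalgebra) : Prop :=
  (w : HT H K →L[ℂ] HT H K) * (α.toHom x : HT H K →L[ℂ] HT H K) =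
    opTensor (x : H →L[ℂ] H) (1 : K →L[ℂ] K)

variable {α}

/-- For `x = (id ⊗ ω_Ω)(wX)`, the operator `w α(x)` is the `Ω`-slice in the last leg of `(w ⊗ 1)(α ⊗
id)(w)(α ⊗ id)(X)`. On `ξ ⊗ k ⊗ Ω = V₂₃*(ξ ⊗ k ⊗ Ω)`, equivariance and the cocycle identity move
`V₂₃*` to the left past everything, leaving `wX` on the outer legs. Slicing at `Ω` then removes
`V₂₃*`, and `xξ ⊗ k` remains. -/
theorem IsCocycle.exists_intertwines_slice {w : (vnTensor 𝓜 𝔾.alg).toStarSubalgebra}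
    (hw : α.IsCocycle w) {X : HT H K →L[ℂ] HT H K} (hX : α.IsEquivariant X) :
    ∃ h : sliceR 𝔾.Ω 𝔾.Ω ((w : HT H K →L[ℂ] HT H K) * X) ∈ 𝓜,
      α.Intertwines w (elem 𝓜 _ h) := by
  obtain ⟨Y, hY, hk⟩ := hX
  set W : HT H K →L[ℂ] HT H K := (w : HT H K →L[ℂ] HT H K) with hW
  set Z := tensorId α.toHom 𝔾.alg w with hZ
  obtain ⟨h, hs⟩ := (isAmplification_tensorId α.toHom 𝔾.alg w).mul α.normal hY 𝔾.Ω 𝔾.Ω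
  refine ⟨h, clm_ext fun ξ k => ?_⟩
  rw [mul_apply_eq_comp, ← hs, ← hW, ← hZ]
  have h1 : opTensor W 1 ∘L (Z ∘L (Y ∘L 𝔾.coactionLeg H k)) =
      𝔾.coactionLeg H k ∘L (W ∘L X) := by
    rw [hk, ← ContinuousLinearMap.comp_assoc, ← ContinuousLinearMap.comp_assoc,
      ← ContinuousLinearMap.comp_assoc]
    congr 1
    have h2 := hw.2
    change opTensor W 1 ∘L Z = _ at h2
    rw [h2, 𝔾.reassoc_idTensor_coactionLeg]
  have h3 := DFunLike.congr_fun (adjoint_rightLeg_opTensor_one W 𝔾.Ω)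
    (Z (Y (tmul (tmul ξ k) 𝔾.Ω)))
  have h4 := DFunLike.congr_fun h1 (tmul ξ 𝔾.Ω)
  have h5 := DFunLike.congr_fun (𝔾.adjoint_rightLeg_coactionLeg (H := H) k)
    (W (X (tmul ξ 𝔾.Ω)))
  simp only [ContinuousLinearMap.comp_apply, 𝔾.coactionLeg_tmul_Ω] at h3 h4 h5
  rw [h4, h5] at h3
  rw [opTensor_tmul]
  exact h3.symm

theorem one_opTensor_mem_crossedProduct {T : K →L[ℂ] K} (hT : T ∈ 𝔾.dualAlg.commutant) :
    opTensor 1 T ∈ α.crossedProduct :=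
  subset_generatedBy _ (Or.inr ⟨T, hT, rfl⟩)

theorem toHom_mem_crossedProduct (x : 𝓜.toStarSubalgebra) :
    (α.toHom x : HT H K →L[ℂ] HT H K) ∈ α.crossedProduct :=
  subset_generatedBy _ (Or.inl ⟨x, rfl⟩)

/-- Compression by the vacuum projection in the second leg is slicing at `Ω`; this turns statements
about the crossed product into statements about intertwiners. -/
theorem opTensor_vacuum_mul (S : H →L[ℂ] H) (X : HT H K →L[ℂ] HT H K) (S' : H →L[ℂ] H) :
    opTensor S 𝔾.vacuum * X * opTensor S' 𝔾.vacuum =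
      opTensor (S * sliceR 𝔾.Ω 𝔾.Ω X * S') 𝔾.vacuum :=
  clm_ext fun ξ k => by
    have h : ∀ x : HT H K, opTensor S 𝔾.vacuum x = tmul (S ((rightLeg 𝔾.Ω).adjoint x)) 𝔾.Ω := by
      have : opTensor S 𝔾.vacuum = rightLeg 𝔾.Ω ∘L S ∘L (rightLeg 𝔾.Ω).adjoint :=
        clm_ext fun a b => by simp [𝔾.vacuum_apply, tmul_smul]
      exact DFunLike.congr_fun this
    rw [mul_apply_eq_comp, mul_apply_eq_comp, h, opTensor_tmul, opTensor_tmul,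
      𝔾.vacuum_apply, tmul_smul, tmul_smul, map_smul, map_smul, map_smul, smul_tmul]
    rfl

theorem opTensor_vacuum_eq_zero {S : H →L[ℂ] H} (h : opTensor S 𝔾.vacuum = 0) : S = 0 := by
  ext ξ
  have h2 := DFunLike.congr_fun h (tmul ξ 𝔾.Ω)
  rw [opTensor_tmul, 𝔾.vacuum_apply, 𝔾.inner_Ω_Ω, one_smul] at h2
  exact tmul_eq_zero h2 𝔾.Ω_ne_zero

/-- If the crossed product is a factor, a nonzero `α`-fixed element `e` and a nonzero `f` are
linked by some intertwiner. -/
theorem IsCocycle.eq_zero_or_eq_zero (hfactor : IsFactor α.crossedProduct)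
    {w : (vnTensor 𝓜 𝔾.alg).toStarSubalgebra} (hw : α.IsCocycle w) {e f : H →L[ℂ] H}
    (he : opTensor e (1 : K →L[ℂ] K) ∈ α.crossedProduct)
    (hef : ∀ x, α.Intertwines w x → f * (x : H →L[ℂ] H) * e = 0) : e = 0 ∨ f = 0 := by
  set R := α.crossedProduct with hR
  set Q : HT H K →L[ℂ] HT H K := opTensor e 𝔾.vacuum with hQ
  have hQmem : Q ∈ R := by
    have : Q = opTensor e (1 : K →L[ℂ] K) * opTensor 1 𝔾.vacuum := by
      rw [opTensor_mul, mul_one, one_mul]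
    rw [this]
    exact mul_mem he (one_opTensor_mem_crossedProduct 𝔾.vacuum_mem)
  -- Membership of `X` in `R` makes the span invariant under `R'`; equivariance of `X` makes its
  -- slices against `w` intertwiners.
  let G : Set (HT H K) := {u | ∃ X, (X ∈ R ∧ α.IsEquivariant X) ∧ ∃ v, u = X (Q v)}
  let U : Submodule ℂ (HT H K) := (Submodule.span ℂ G).topologicalClosure
  have hUc : IsClosed (U : Set (HT H K)) := Submodule.isClosed_topologicalClosure _
  have : CompleteSpace U := hUc.completeSpace_coe
  have hGU : ∀ u ∈ G, u ∈ U := fun u hu =>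
    Submodule.le_topologicalClosure _ (Submodule.subset_span hu)
  have hle : ∀ U' : Submodule ℂ (HT H K), IsClosed (U' : Set (HT H K)) → G ⊆ U' → U ≤ U' :=
    fun U' h h' => Submodule.topologicalClosure_minimal _ (Submodule.span_le.2 h') h
  have hinv : ∀ g : HT H K →L[ℂ] HT H K, (∀ u ∈ G, g u ∈ G) → ∀ v ∈ U, g v ∈ U := fun g hg =>
    hle (U.comap g.toLinearMap) (hUc.preimage g.continuous) fun u hu => hGU _ (hg u hu)
  have hcomm : R.commutant = commutantOf _ := commutant_generatedBy _
  have hzR : U.starProjection ∈ R := by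
    rw [hR, crossedProduct, generatedBy, VonNeumannAlgebra.mem_commutant_iff, ← hcomm]
    have key : ∀ g ∈ R.commutant, ∀ v ∈ U, g v ∈ U := fun g hg => hinv g (by
      rintro _ ⟨X, hX, v, rfl⟩
      rw [VonNeumannAlgebra.mem_commutant_iff] at hg
      refine ⟨X, hX, g v, ?_⟩
      have h1 := DFunLike.congr_fun (hg X hX.1) (Q v)
      have h2 := DFunLike.congr_fun (hg Q hQmem) v
      simp only [mul_apply_eq_comp] at h1 h2
      rw [← h1, ← h2])
    exact fun g hg => commute_starProjection (key g hg) (key _ (star_mem hg))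
  have hzR' : U.starProjection ∈ R.commutant := by
    -- Commutation need only be tested on the generators of `R`, which are equivariant, so
    -- equivariance never has to pass to weak limits.
    have key : ∀ g ∈ R, α.IsEquivariant g → ∀ v ∈ U, g v ∈ U := fun g hg hg' => hinv g (by
      rintro _ ⟨X, hX, v, rfl⟩
      exact ⟨g * X, ⟨mul_mem hg hX.1, hg'.mul α hX.2⟩, v, rfl⟩)
    have key2 : ∀ g ∈ R, star g ∈ R → α.IsEquivariant g → α.IsEquivariant (star g) →
        g * U.starProjection = U.starProjection * g ∧
          star g * U.starProjection = U.starProjection * star g := fun g h1 h2 h3 h4 =>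
      ⟨commute_starProjection (key g h1 h3) (key _ h2 h4), commute_starProjection (key _ h2 h4)
        (by rw [ContinuousLinearMap.star_eq_adjoint, ContinuousLinearMap.adjoint_adjoint]
            exact key g h1 h3)⟩
    rw [hcomm, mem_commutantOf]
    rintro _ (⟨x, rfl⟩ | ⟨T, hT, rfl⟩)
    · have hs : star (α.toHom x : HT H K →L[ℂ] HT H K) =
          (α.toHom (star x) : HT H K →L[ℂ] HT H K) := by rw [map_star]; rfl
      refine key2 _ (toHom_mem_crossedProduct x) (star_mem (toHom_mem_crossedProduct x))
        (α.isEquivariant_toHom x) ?_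
      rw [hs]
      exact α.isEquivariant_toHom _
    · have h := one_opTensor_mem_crossedProduct (α := α) hT
      refine key2 _ h (star_mem h) (α.isEquivariant_one_opTensor hT) ?_
      rw [star_opTensor, star_one]
      exact α.isEquivariant_one_opTensor (star_mem hT)
  obtain ⟨c, hc⟩ := hfactor _ hzR hzR'
  have hQU : ∀ v, Q v ∈ U := fun v => hGU _ ⟨1, ⟨one_mem R, by
    simpa using α.isEquivariant_toHom 1⟩, v, rfl⟩
  by_cases hc0 : c = 0
  · left
    refine opTensor_vacuum_eq_zero (𝔾 := 𝔾) (ContinuousLinearMap.ext fun v => ?_)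
    have h := Submodule.starProjection_eq_self_iff.2 (hQU v)
    rw [hc, hc0, zero_smul] at h
    exact h.symm
  · right
    have hU : ∀ v, v ∈ U := fun v => by
      have h := Submodule.starProjection_apply_mem U v
      rw [hc] at h
      exact (U.smul_mem_iff hc0).1 h
    -- The kernel of `(f ⊗ p)w` is a closed subspace containing each `X(e ⊗ p)v`, since `(f ⊗ p) w X
    -- (e ⊗ p) = f x e ⊗ p` with `x` an intertwiner.
    have hker : ∀ v, (opTensor f 𝔾.vacuum * (w : HT H K →L[ℂ] HT H K)) v = 0 := fun v => by
      refine hle (LinearMap.ker (opTensor f 𝔾.vacuum * (w : HT H K →L[ℂ] HT H K)).toLinearMap)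
        (ContinuousLinearMap.isClosed_ker _) ?_ (hU v)
      rintro _ ⟨X, ⟨-, hX⟩, v, rfl⟩
      obtain ⟨h, hint⟩ := hw.exists_intertwines_slice hX
      have h1 := hef _ hint
      have h2 := opTensor_vacuum_mul (𝔾 := 𝔾) f ((w : HT H K →L[ℂ] HT H K) * X) e
      change f * sliceR 𝔾.Ω 𝔾.Ω _ * e = 0 at h1
      have h0 : opTensor (0 : H →L[ℂ] H) 𝔾.vacuum = 0 := by
        simpa using opTensor_smul_left (0 : ℂ) (0 : H →L[ℂ] H) 𝔾.vacuum
      rw [h1, h0] at h2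
      exact DFunLike.congr_fun h2 v
    refine opTensor_vacuum_eq_zero (𝔾 := 𝔾) ?_
    have h1 : opTensor f 𝔾.vacuum * (w : HT H K →L[ℂ] HT H K) = 0 :=
      ContinuousLinearMap.ext hker
    have h2 : (w : HT H K →L[ℂ] HT H K) * star (w : HT H K →L[ℂ] HT H K) = 1 :=
      congrArg Subtype.val (Unitary.mul_star_self_of_mem hw.1)
    rw [← mul_one (opTensor f 𝔾.vacuum), ← h2, ← mul_assoc, h1, zero_mul]

end Action

/-! ### Extreme points of the unit ball of a ternary ring of operators -/

section ExtremePoints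

variable {H : Type*} [NormedAddCommGroup H] [InnerProductSpace ℂ H] [CompleteSpace H]

/-- Weak limits of contractions are contractions. -/
theorem exists_clm_of_tendsto_inner {ι : Type*} {l : Filter ι} [l.NeBot] {T : ι → H →L[ℂ] H}
    (hT : ∀ᶠ i in l, ‖T i‖ ≤ 1) {f : H → H → ℂ}
    (h : ∀ ξ η, Tendsto (fun i => inner ℂ ξ (T i η)) l (𝓝 (f ξ η))) :
    ∃ x : H →L[ℂ] H, ‖x‖ ≤ 1 ∧ ∀ ξ η, inner ℂ ξ (x η) = f ξ η := by
  have hbound : ∀ ξ η, ‖f ξ η‖ ≤ ‖ξ‖ * ‖η‖ := fun ξ η => by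
    refine le_of_tendsto (h ξ η).norm ?_
    filter_upwards [hT] with i hi
    refine (norm_inner_le_norm _ _).trans (mul_le_mul_of_nonneg_left ?_ (norm_nonneg _))
    simpa using (T i).le_of_opNorm_le hi η
  let B : H →L⋆[ℂ] H →L[ℂ] ℂ := LinearMap.mkContinuous₂
    (LinearMap.mk₂'ₛₗ (starRingEnd ℂ) (RingHom.id ℂ) f
      (fun a b η => tendsto_nhds_unique (h (a + b) η) (by
        simpa only [inner_add_left] using (h a η).add (h b η)))
      (fun c a η => tendsto_nhds_unique (h (c • a) η) (by
        simpa only [inner_smul_left, smul_eq_mul] using (h a η).const_mul (starRingEnd ℂ c)))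
      (fun a η η' => tendsto_nhds_unique (h a (η + η')) (by
        simpa only [map_add, inner_add_right] using (h a η).add (h a η')))
      (fun c a η => tendsto_nhds_unique (h a (c • η)) (by
        simpa only [map_smul, inner_smul_right, smul_eq_mul, RingHom.id_apply] using (h a η).const_mul c)))
    1 (fun ξ η => by simpa using hbound ξ η)
  have hx : ∀ ξ η, inner ℂ ξ ((InnerProductSpace.continuousLinearMapOfBilin B).adjoint η) =
      f ξ η := fun ξ η => by
    rw [ContinuousLinearMap.adjoint_inner_right,
      InnerProductSpace.continuousLinearMapOfBilin_apply]
    rfl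
  refine ⟨_, ContinuousLinearMap.opNorm_le_bound _ zero_le_one fun η => ?_, hx⟩
  -- Testing the form against `ξ = xη` gives `‖xη‖² ≤ ‖xη‖‖η‖`.
  have h2 := hbound ((InnerProductSpace.continuousLinearMapOfBilin B).adjoint η) η
  rw [← hx, inner_self_eq_norm_sq_to_K, one_mul] at *
  simp only [norm_pow, Complex.norm_real, norm_norm, Complex.coe_algebraMap] at h2
  rw [pow_two] at h2
  by_contra hlt
  rw [not_le] at hlt
  nlinarith [norm_nonneg η]

/-- The matrix coefficients of an operator. -/
def coefficients (H : Type*) [NormedAddCommGroup H] [InnerProductSpace ℂ H] :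
    (H →L[ℂ] H) →ₗ[ℂ] (H → H → ℂ) where
  toFun T ξ η := inner ℂ ξ (T η)
  map_add' S T := by ext; simp
  map_smul' c T := by ext; simp

theorem coefficients_injective : Function.Injective (coefficients H) := fun S T h => by
  ext η
  exact ext_inner_left ℂ fun ξ => congrFun (congrFun h ξ) η

/-- A set of contractions closed under weak limits is compact. -/
theorem isCompact_coefficients {B : Set (H →L[ℂ] H)} (hB : ∀ x ∈ B, ‖x‖ ≤ 1)
    (hcl : ∀ (l : Filter (H →L[ℂ] H)) [l.NeBot], (∀ᶠ y in l, y ∈ B) → ∀ x : H →L[ℂ] H,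
      (∀ ξ η, Tendsto (fun y => inner ℂ ξ (y η)) l (𝓝 (inner ℂ ξ (x η)))) → ‖x‖ ≤ 1 → x ∈ B) :
    IsCompact (coefficients H '' B) := by
  have hc : IsCompact (Set.univ.pi fun ξ : H => Set.univ.pi fun η : H =>
      Metric.closedBall (0 : ℂ) (‖ξ‖ * ‖η‖)) :=
    isCompact_univ_pi fun ξ => isCompact_univ_pi fun η => isCompact_closedBall _ _
  refine hc.of_isClosed_subset (isClosed_of_closure_subset fun f hf => ?_) ?_
  · have hne : (comap (coefficients H) (𝓝[coefficients H '' B] f)).NeBot := by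
      have := mem_closure_iff_nhdsWithin_neBot.1 hf
      refine NeBot.comap_of_image_mem (m := coefficients H) (s := B) this self_mem_nhdsWithin
    set l := comap (coefficients H) (𝓝[coefficients H '' B] f)
    have hlB : ∀ᶠ y in l, y ∈ B := by
      refine ⟨coefficients H '' B, self_mem_nhdsWithin, ?_⟩
      rw [Set.preimage_image_eq _ coefficients_injective]
      exact fun y hy => hy
    have hlim : Tendsto (coefficients H) l (𝓝 f) := tendsto_comap.mono_right nhdsWithin_le_nhds
    have hlim2 : ∀ ξ η, Tendsto (fun y : H →L[ℂ] H => inner ℂ ξ (y η)) l (𝓝 (f ξ η)) :=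
      fun ξ η => tendsto_pi_nhds.1 (tendsto_pi_nhds.1 hlim ξ) η
    obtain ⟨x, hx1, hx⟩ := exists_clm_of_tendsto_inner (hlB.mono fun y hy => hB y hy) hlim2
    refine ⟨x, hcl l hlB x (fun ξ η => by rw [hx]; exact hlim2 ξ η) hx1, ?_⟩
    ext ξ η
    exact hx ξ η
  · rintro _ ⟨x, hx, rfl⟩ ξ - η -
    rw [mem_closedBall_zero_iff]
    refine (norm_inner_le_norm _ _).trans (mul_le_mul_of_nonneg_left ?_ (norm_nonneg _))
    simpa using x.le_of_opNorm_le (hB x hx) η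

theorem norm_le_of_star_mul_le {x : H →L[ℂ] H} {c : ℝ} (hc : 0 ≤ c)
    (h : star x * x ≤ algebraMap ℝ (H →L[ℂ] H) (c ^ 2)) : ‖x‖ ≤ c := by
  have h1 : ‖star x * x‖ ≤ c ^ 2 := (CStarAlgebra.norm_le_iff_le_algebraMap _ (sq_nonneg c)
    (star_mul_self_nonneg x)).2 h
  rw [CStarRing.norm_star_mul_self] at h1
  nlinarith [norm_nonneg x]

theorem star_mul_self_le_one {x : H →L[ℂ] H} (h : ‖x‖ ≤ 1) : star x * x ≤ 1 := by
  have h1 : ‖star x * x‖ ≤ 1 := by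
    rw [CStarRing.norm_star_mul_self]; nlinarith [norm_nonneg x]
  simpa using (CStarAlgebra.norm_le_iff_le_algebraMap _ zero_le_one (star_mul_self_nonneg x)).1 h1

/-- With `a = s*s` the claim is `a(3 - a)² ≤ 4`, and `4 - a(3 - a)² = (1 - a)(4 - a)(1 - a) ≥ 0`. -/
theorem norm_mul_three_sub_le {s : H →L[ℂ] H} (h : ‖s‖ ≤ 1) :
    ‖s * (3 - star s * s)‖ ≤ 2 := by
  refine norm_le_of_star_mul_le zero_le_two ?_
  set a := star s * s with ha
  have hsa : star a = a := by simp [ha]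
  have h1 : 0 ≤ 1 - a := sub_nonneg.2 (star_mul_self_le_one h)
  have h3 : star (3 : H →L[ℂ] H) = 3 := star_ofNat 3
  have h4 : (0 : H →L[ℂ] H) ≤ 3 + (1 - a) := add_nonneg (by
    have : (3 : H →L[ℂ] H) = 1 + 1 + 1 := by norm_num
    rw [this]
    have h0 : (0 : H →L[ℂ] H) ≤ 1 := zero_le_one
    exact add_nonneg (add_nonneg h0 h0) h0) h1
  have h5 := star_left_conjugate_nonneg h4 (1 - a)
  rw [star_mul, star_sub, h3, hsa, ← sub_nonneg]
  have h6 : (3 - a) * star s * (s * (3 - a)) = (3 - a) * a * (3 - a) := by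
    rw [ha]; noncomm_ring
  have h7 : algebraMap ℝ (H →L[ℂ] H) (2 ^ 2) = 1 + 1 + 1 + 1 := by
    rw [show (2 : ℝ) ^ 2 = 1 + 1 + 1 + 1 by norm_num]; simp only [map_add, map_one]
  rw [h6, h7]
  convert h5 using 1
  rw [star_sub, star_one, hsa]
  noncomm_ring

/-- `s` and `y` have orthogonal ranges and orthogonal initial spaces, so `1 - (s + y)*(s + y)` is
the compression of `1 - y*y ≥ 0` by the projection `1 - s*s`. -/
theorem norm_add_le_one {s y : H →L[ℂ] H} (hs : s * star s * s = s) (hy : ‖y‖ ≤ 1)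
    (h : star s * y = 0) (h' : y * star s = 0) : ‖s + y‖ ≤ 1 := by
  refine norm_le_of_star_mul_le zero_le_one ?_
  have h1 : star y * s = 0 := by simpa using congrArg star h
  have h2 : s * star y = 0 := by simpa using congrArg star h'
  have h3 := star_left_conjugate_nonneg (sub_nonneg.2 (star_mul_self_le_one hy))
    (1 - star s * s)
  rw [one_pow, map_one, ← sub_nonneg]
  convert h3 using 1
  have h4 : star s * s * (star s * s) = star s * s := by
    rw [mul_assoc, ← mul_assoc s, hs]
  have h5 : y * (1 - star s * s) = y := by rw [mul_sub, ← mul_assoc, h']; simp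
  have h6 : star (1 - star s * s) = 1 - star s * s := by simp
  have h7 : (1 - star s * s) * star y = star y := by
    have := congrArg star h5
    rwa [star_mul, h6] at this
  have h8 : (1 - star s * s) * (1 - star s * s) = 1 - star s * s := by
    rw [mul_sub, sub_mul, sub_mul, h4]; simp
  have h9 : ∀ p : H →L[ℂ] H, p * (1 - star y * y) * p = p * p - (p * star y) * (y * p) :=
    fun p => by noncomm_ring
  rw [h6, h9, h8, h7, h5, star_add, add_mul, mul_add, mul_add, h, h1]
  abel

/-- Kadison's description of the extreme points of the unit ball, for a weakly closed ternary
ring of operators. -/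
theorem exists_maximal_partialIsometry (𝒳 : Submodule ℂ (H →L[ℂ] H))
    (hmul : ∀ x ∈ 𝒳, ∀ y ∈ 𝒳, ∀ z ∈ 𝒳, x * star y * z ∈ 𝒳)
    (hcl : ∀ (l : Filter (H →L[ℂ] H)) [l.NeBot], (∀ᶠ y in l, y ∈ 𝒳 ∧ ‖y‖ ≤ 1) →
      ∀ x : H →L[ℂ] H,
        (∀ ξ η, Tendsto (fun y => inner ℂ ξ (y η)) l (𝓝 (inner ℂ ξ (x η)))) → x ∈ 𝒳) :
    ∃ s ∈ 𝒳, ∀ x ∈ 𝒳, (1 - s * star s) * x * (1 - star s * s) = 0 := by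
  let B : Set (H →L[ℂ] H) := {x | x ∈ 𝒳 ∧ ‖x‖ ≤ 1}
  have hcomp : IsCompact (coefficients H '' B) := isCompact_coefficients (fun x hx => hx.2)
    (fun l _ hl x hx hx1 => ⟨hcl l hl x hx, hx1⟩)
  obtain ⟨_, ⟨s, ⟨hs, hs1⟩, rfl⟩, hext⟩ := hcomp.extremePoints_nonempty
    ⟨_, 0, ⟨𝒳.zero_mem, by simp⟩, rfl⟩
  have hzero : ∀ y ∈ 𝒳, ‖s + y‖ ≤ 1 → ‖s - y‖ ≤ 1 → y = 0 := fun y hy h1 h2 => by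
    have h3 : coefficients H s ∈ openSegment ℝ (coefficients H (s + y)) (coefficients H (s - y)) :=
      ⟨1 / 2, 1 / 2, by norm_num, by norm_num, by norm_num, by
        ext ξ η
        simp only [map_add, map_sub, Pi.add_apply, Pi.smul_apply, Pi.sub_apply, Complex.real_smul]
        push_cast
        ring⟩
    have h4 := hext ⟨_, ⟨𝒳.add_mem hs hy, h1⟩, rfl⟩ ⟨_, ⟨𝒳.sub_mem hs hy, h2⟩, rfl⟩ h3
    simpa using coefficients_injective h4
  -- The perturbation `½(s - ss*s)` lies in the ternary ring, and adding it to or subtracting it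
  -- from `s` stays in the ball: the results are `½ s(3 - s*s)` and `½(s + ss*s)`. Extremality makes
  -- it vanish without any functional calculus.
  have hpi : s * star s * s = s := by
    have h1 := hzero ((2⁻¹ : ℂ) • (s - s * star s * s))
      (𝒳.smul_mem _ (𝒳.sub_mem hs (hmul s hs s hs s hs))) (by
        have h : s + (2⁻¹ : ℂ) • (s - s * star s * s) = (2⁻¹ : ℂ) • (s * (3 - star s * s)) := by
          have h3 : s * 3 = (3 : ℂ) • s := by
            rw [Algebra.smul_def, Algebra.commutes, map_ofNat]
          rw [mul_sub, h3, mul_assoc]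
          module
        rw [h, norm_smul]
        have := norm_mul_three_sub_le hs1
        norm_num
        linarith) (by
        have h : s - (2⁻¹ : ℂ) • (s - s * star s * s) = (2⁻¹ : ℂ) • (s + s * star s * s) := by
          module
        have h2 : ‖s * star s * s‖ ≤ 1 := by
          refine (norm_mul_le _ _).trans (mul_le_one₀ ?_ (norm_nonneg _) hs1)
          exact (norm_mul_le _ _).trans (mul_le_one₀ hs1 (norm_nonneg _) (by rwa [norm_star]))
        rw [h, norm_smul]
        have := norm_add_le s (s * star s * s)
        norm_num
        linarith)
    have h2 := (smul_eq_zero.1 h1).resolve_left (by norm_num)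
    exact (sub_eq_zero.1 h2).symm
  refine ⟨s, hs, fun x hx => ?_⟩
  set y := (1 - s * star s) * x * (1 - star s * s) with hy
  have hymem : y ∈ 𝒳 := by
    have : y = x - s * star s * x - x * star s * s + (s * star s * x) * star s * s := by
      rw [hy]; noncomm_ring
    rw [this]
    exact 𝒳.add_mem (𝒳.sub_mem (𝒳.sub_mem hx (hmul s hs s hs x hx)) (hmul x hx s hs s hs))
      (hmul _ (hmul s hs s hs x hx) s hs s hs)
  have hpi' : star s * s * star s = star s := by
    simpa [mul_assoc] using congrArg star hpi
  have h1 : star s * y = 0 := by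
    have : star s * (1 - s * star s) = 0 := by rw [mul_sub, ← mul_assoc, hpi']; simp
    rw [hy, ← mul_assoc, ← mul_assoc, this]; simp
  have h2 : y * star s = 0 := by
    have : (1 - star s * s) * star s = 0 := by rw [sub_mul, hpi']; simp
    rw [hy, mul_assoc, this, mul_zero]
  -- A nonzero scale that makes `cy` a contraction; then `s ± cy` stay in the ball and extremality
  -- forces `y = 0`.
  set c : ℂ := (((1 + ‖y‖)⁻¹ : ℝ) : ℂ) with hc
  have hcy : ‖c • y‖ ≤ 1 := by
    rw [norm_smul, hc, Complex.norm_real, Real.norm_of_nonneg (by positivity),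
      inv_mul_le_iff₀ (by positivity)]
    linarith
  have h3 := hzero (c • y) (𝒳.smul_mem _ hymem)
    (norm_add_le_one hpi hcy (by simp [h1]) (by simp [h2])) (by
      rw [sub_eq_add_neg]
      exact norm_add_le_one hpi (by rwa [norm_neg]) (by simp [h1]) (by simp [h2]))
  refine (smul_eq_zero.1 h3).resolve_left ?_
  rw [hc, Complex.ofReal_eq_zero]
  positivity

end ExtremePoints

/-! ### The ternary ring of intertwiners -/

namespace Action

variable {H K : Type*}
  [NormedAddCommGroup H] [InnerProductSpace ℂ H] [CompleteSpace H]
  [NormedAddCommGroup K] [InnerProductSpace ℂ K] [CompleteSpace K]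
  {𝔾 : CompactKacAlgebra K} {𝓜 : VonNeumannAlgebra H} (α : Action 𝔾 𝓜)
  (w : (vnTensor 𝓜 𝔾.alg).toStarSubalgebra)

/-- The space of intertwiners between `α` and its perturbation by `w`. -/
def intertwiners : Submodule ℂ (H →L[ℂ] H) where
  carrier := {x | ∃ h : x ∈ 𝓜, α.Intertwines w (elem 𝓜 x h)}
  zero_mem' := ⟨zero_mem 𝓜.toStarSubalgebra, by
    have h0 : opTensor (0 : H →L[ℂ] H) (1 : K →L[ℂ] K) = 0 := by
      simpa using opTensor_smul_left (0 : ℂ) (0 : H →L[ℂ] H) (1 : K →L[ℂ] K)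
    change _ * (α.toHom 0 : HT H K →L[ℂ] HT H K) = opTensor (0 : H →L[ℂ] H) 1
    rw [h0, map_zero]
    exact mul_zero _⟩
  add_mem' := by
    rintro x y ⟨hx, hx'⟩ ⟨hy, hy'⟩
    refine ⟨𝓜.toStarSubalgebra.add_mem hx hy, ?_⟩
    change _ * (α.toHom (elem 𝓜 x hx + elem 𝓜 y hy) : HT H K →L[ℂ] HT H K) = opTensor (x + y) 1
    rw [map_add, opTensor_add_left]
    exact (mul_add _ _ _).trans (congrArg₂ (· + ·) hx' hy')
  smul_mem' := by
    rintro c x ⟨hx, hx'⟩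
    refine ⟨𝓜.toStarSubalgebra.smul_mem hx c, ?_⟩
    change _ * (α.toHom (c • elem 𝓜 x hx) : HT H K →L[ℂ] HT H K) = opTensor (c • x) 1
    rw [map_smul, opTensor_smul_left]
    exact (mul_smul_comm _ _ _).trans (congrArg (c • ·) hx')

variable {α w}

theorem IsCocycle.toHom_eq (hw : α.IsCocycle w) {x : 𝓜.toStarSubalgebra}
    (hx : α.Intertwines w x) : (α.toHom x : HT H K →L[ℂ] HT H K) =
      star (w : HT H K →L[ℂ] HT H K) * opTensor (x : H →L[ℂ] H) 1 := by
  have h : star (w : HT H K →L[ℂ] HT H K) * (w : HT H K →L[ℂ] HT H K) = 1 :=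
    congrArg Subtype.val (Unitary.star_mul_self_of_mem hw.1)
  rw [← (show _ = _ from hx), ← mul_assoc, h, one_mul]

theorem coe_toHom_star (x : 𝓜.toStarSubalgebra) :
    (α.toHom (star x) : HT H K →L[ℂ] HT H K) = star (α.toHom x : HT H K →L[ℂ] HT H K) := by
  rw [map_star]; rfl

theorem coe_toHom_mul (x y : 𝓜.toStarSubalgebra) : (α.toHom (x * y) : HT H K →L[ℂ] HT H K) =
    (α.toHom x : HT H K →L[ℂ] HT H K) * (α.toHom y : HT H K →L[ℂ] HT H K) := by
  rw [map_mul]; rfl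

/-- The product is `(x* ⊗ 1) w w* (y ⊗ 1)` and `w` is unitary. So `x*y` is a fixed point of `α`. -/
theorem IsCocycle.toHom_star_mul (hw : α.IsCocycle w) {x y : 𝓜.toStarSubalgebra}
    (hx : α.Intertwines w x) (hy : α.Intertwines w y) :
    (α.toHom (star x * y) : HT H K →L[ℂ] HT H K) =
      opTensor (star (x : H →L[ℂ] H) * (y : H →L[ℂ] H)) 1 := by
  have h : (w : HT H K →L[ℂ] HT H K) * star (w : HT H K →L[ℂ] HT H K) = 1 :=
    congrArg Subtype.val (Unitary.mul_star_self_of_mem hw.1)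
  rw [coe_toHom_mul, coe_toHom_star, hw.toHom_eq hx, hw.toHom_eq hy, star_mul, star_star,
    mul_assoc, ← mul_assoc _ (star _), h, one_mul, star_opTensor, opTensor_mul, star_one, one_mul]

/-- Multiplying an intertwiner on the right by the fixed point `y*z` yields an intertwiner. -/
theorem IsCocycle.mul_star_mul_mem (hw : α.IsCocycle w) {x y z : H →L[ℂ] H}
    (hx : x ∈ α.intertwiners w) (hy : y ∈ α.intertwiners w) (hz : z ∈ α.intertwiners w) :
    x * star y * z ∈ α.intertwiners w := by
  obtain ⟨hx, hx'⟩ := hx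
  obtain ⟨hy, hy'⟩ := hy
  obtain ⟨hz, hz'⟩ := hz
  refine ⟨mul_mem (mul_mem hx (star_mem hy)) hz, ?_⟩
  have h : elem 𝓜 (x * star y * z) (mul_mem (mul_mem hx (star_mem hy)) hz) =
      elem 𝓜 x hx * (star (elem 𝓜 y hy) * elem 𝓜 z hz) := Subtype.ext (mul_assoc _ _ _)
  rw [Intertwines, h, coe_toHom_mul, hw.toHom_star_mul hy' hz', ← mul_assoc,
    show _ = _ from hx', opTensor_mul, one_mul]
  rfl

/-- Both sides of `w α(y) = y ⊗ 1` are continuous along bounded weak limits, the left one because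
`α` is normal. -/
theorem mem_intertwiners_of_tendsto {l : Filter (H →L[ℂ] H)} [l.NeBot]
    (hl : ∀ᶠ y in l, y ∈ α.intertwiners w ∧ ‖y‖ ≤ 1) {x : H →L[ℂ] H}
    (h : ∀ ξ η, Tendsto (fun y : H →L[ℂ] H => inner ℂ ξ (y η)) l (𝓝 (inner ℂ ξ (x η)))) :
    x ∈ α.intertwiners w := by
  have hx : x ∈ 𝓜 := mem_of_tendsto_inner (hl.mono fun y hy => hy.1.choose) h
  refine ⟨hx, clm_ext_inner fun ξ η ξ' η' => ?_⟩
  classical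
  -- The filter lives on all of `B(H)`; the value `0` outside `𝓜` is never seen, since the operators
  -- are eventually in `𝓜`.
  let X : (H →L[ℂ] H) → 𝓜.toStarSubalgebra := fun y => if hy : y ∈ 𝓜 then elem 𝓜 y hy else 0
  have hX : ∀ y (hy : y ∈ 𝓜), X y = elem 𝓜 y hy := fun y hy => dif_pos hy
  have hX' : ∀ y ∈ 𝓜, (X y : H →L[ℂ] H) = y := fun y hy => by rw [hX y hy]; rfl
  set W : HT H K →L[ℂ] HT H K := (w : HT H K →L[ℂ] HT H K) with hW
  have h1 := α.normal.tendsto_inner (X := X) (x := elem 𝓜 x hx) 1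
    (by filter_upwards [hl] with y hy; rw [hX' y hy.1.choose]; exact hy.2)
    (fun ξ η => (h ξ η).congr' (by
      filter_upwards [hl] with y hy; rw [hX' y hy.1.choose]))
    (W.adjoint (tmul ξ η)) (tmul ξ' η')
  simp only [ContinuousLinearMap.adjoint_inner_left] at h1
  refine tendsto_nhds_unique h1 ?_
  have h2 : Tendsto (fun y : H →L[ℂ] H => inner ℂ (tmul ξ η) (opTensor y (1 : K →L[ℂ] K)
      (tmul ξ' η'))) l (𝓝 (inner ℂ (tmul ξ η) (opTensor x (1 : K →L[ℂ] K) (tmul ξ' η')))) := by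
    simpa using (h ξ ξ').mul_const (inner ℂ η η')
  refine h2.congr' ?_
  filter_upwards [hl] with y hy
  obtain ⟨hy1, hy2⟩ := hy.1
  rw [hX y hy1]
  exact congrArg (fun Z : HT H K →L[ℂ] HT H K => inner ℂ (tmul ξ η) (Z (tmul ξ' η')))
    (show _ = _ from hy2).symm

/-- If the crossed product is a factor, there is an isometric or coisometric intertwiner. -/
theorem IsCocycle.exists_intertwines (hfactor : IsFactor α.crossedProduct) (hw : α.IsCocycle w) :
    ∃ s : 𝓜.toStarSubalgebra, α.Intertwines w s ∧
      (star (s : H →L[ℂ] H) * (s : H →L[ℂ] H) = 1 ∨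
        (s : H →L[ℂ] H) * star (s : H →L[ℂ] H) = 1) := by
  obtain ⟨s, ⟨hs, hs'⟩, hmax⟩ := exists_maximal_partialIsometry (α.intertwiners w)
    (fun x hx y hy z hz => hw.mul_star_mul_mem hx hy hz)
    (fun l _ hl x hx => mem_intertwiners_of_tendsto hl hx)
  refine ⟨elem 𝓜 s hs, hs', ?_⟩
  -- The projection `s*s` is a fixed point, so `s*s ⊗ 1 = α(s*s)` lies in the crossed product.
  have he : opTensor (1 - star s * s) (1 : K →L[ℂ] K) ∈ α.crossedProduct := by
    have h1 : opTensor (star s * s) (1 : K →L[ℂ] K) ∈ α.crossedProduct := by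
      have h2 := toHom_mem_crossedProduct (α := α) (star (elem 𝓜 s hs) * elem 𝓜 s hs)
      rwa [hw.toHom_star_mul hs' hs'] at h2
    have h3 : opTensor (1 - star s * s) (1 : K →L[ℂ] K) = 1 - opTensor (star s * s) 1 :=
      clm_ext fun ξ η => by
        rw [opTensor_tmul, sub_apply, sub_apply,
          opTensor_tmul]
        exact map_sub (rightLeg η) _ _
    rw [h3]
    exact sub_mem (one_mem α.crossedProduct) h1
  rcases hw.eq_zero_or_eq_zero hfactor he (f := 1 - s * star s)
    (fun x hx => hmax x ⟨x.2, hx⟩) with h | h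
  · exact Or.inl (sub_eq_zero.1 h).symm
  · exact Or.inr (sub_eq_zero.1 h).symm

end Action

end

end KacAction

theorem mainTheorem11 {H K : Type*}
    [NormedAddCommGroup H] [InnerProductSpace ℂ H] [CompleteSpace H]
    [NormedAddCommGroup K] [InnerProductSpace ℂ K] [CompleteSpace K]
    (𝔾 : KacAction.CompactKacAlgebra K) (𝓜 : VonNeumannAlgebra H)
    (h𝓜 : KacAction.IsFinite 𝓜) (α : KacAction.Action 𝔾 𝓜)
    (hfactor : KacAction.IsFactor α.crossedProduct)
    (w : (KacAction.vnTensor 𝓜 𝔾.alg).toStarSubalgebra) (hw : α.IsCocycle w) :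
    α.IsCoboundary w := by
  obtain ⟨s, hs, h⟩ := hw.exists_intertwines hfactor
  -- In the coisometric case `s*` is an isometry of `𝓜`, so finiteness applies to `s*`.
  have h1 : star (s : H →L[ℂ] H) * (s : H →L[ℂ] H) = 1 := h.elim id fun h' => by
    have := h𝓜 (star (s : H →L[ℂ] H)) (star_mem s.2) (by rwa [star_star])
    rwa [star_star] at this
  have h2 : (s : H →L[ℂ] H) * star (s : H →L[ℂ] H) = 1 := h𝓜 _ s.2 h1
  refine ⟨star s, Unitary.mem_iff.2 ⟨?_, ?_⟩, ?_⟩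
  · rw [star_star]; exact Subtype.ext h2
  · rw [star_star]; exact Subtype.ext h1
  · rw [star_star, mul_assoc, show _ = _ from hs, KacAction.opTensor_mul, one_mul]
    refine (congrArg (fun T => KacAction.opTensor T 1) h1).trans ?_
    exact KacAction.clm_ext fun ξ η => by simp
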